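/- **Index coding.** A unicast index coding instance $\mathcal I=\{B_i,\ i\in[m]\}$ of size $m$ consists of sets $B_i\subseteq[m]\setminus\{i\}$ (interfering messages); user $i$ requests message $i$ and knows the messages in $A_i=[m]\setminus(B_i\cup\{i\})$. A $(t,r)$ index code over an alphabet $\mathcal X$ is an encoder $\phi:\mathcal X^{mt}\to\mathcal X^r$ (each message is a word in $\mathcal X^t$) with decoders $\psi_i:\mathcal X^r\times\mathcal X^{|A_i|t}\to\mathcal X^t$ which always recover message $i$ from the broadcast and the messages in $A_i$; its rate is $r/t$ ($t\ge1$). The broadcast rate $\beta(\mathcal I)$ is the infimum of the rates of all index codes over $\mathcal X$. For a field $\mathbb F$, $\lambda_{\mathbb F}(\mathcal I)$ is the infimum of the rates of the codes over $\mathcal X=\mathbb F$ whose encoder and decoders are $\mathbb F$-linear, and $\lambda(\mathcal I)=\inf_{q}\lambda_{\mathbb F_q}(\mathcal I)$ over all finite fields $\mathbb F_q$. A set $M\subseteq[m]$ is a minimal cyclic set if it can be enumerated without repetition as $i_1,\dots,i_n$, $n\ge2$, such that $B_{i_j}\cap M=M\setminus\{i_j,i_{j+1}\}$ for all $j$ (with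 $i_{n+1}=i_1$). The instance is acyclic if no subset of $[m]$ is a minimal cyclic set. For instances $\mathcal I=\{B_i\}$ and $\mathcal J=\{C_k\}$ on disjoint sets of messages $M_{\mathcal I}$ and $M_{\mathcal J}$, both connections are instances on $M_{\mathcal I}\cup M_{\mathcal J}$: the no-way connection $\mathcal I\nleftrightarrow\mathcal J$ has interfering sets $B_i\cup M_{\mathcal J}$ ($i\in M_{\mathcal I}$) and $C_k\cup M_{\mathcal I}$ ($k\in M_{\mathcal J}$); the two-way connection $\mathcal I\leftrightarrow\mathcal J$ has interfering sets $B_i$ and $C_k$. Write $[n]=\{1,\dots,n\}$ and $[a:b]=\{a,a+1,\dots,b\}$. The instance $\mathcal I_1$ of size 29 is: $B_{1}=([4] \setminus \{1\}) \cup \{8\} \cup ([10:25] \setminus \{10, 14, 18, 22\})$, $B_{2}=([4] \setminus \{2\}) \cup \{7\} \cup ([10:25] \setminus \{11, 15, 19, 23\})$, $B_{3}=([4] \setminus \{3\}) \cup \{6\} \cup ([10:25] \setminus \{12, 16, 20, 24\})$, $B_{4}=([4] \setminus \{4\}) \cup \{5\} \cup ([10:25] \setminus \{13, 17, 21, 25\})$,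 $B_{5}=\{7, 8\}$, $B_{6}=\{5, 8\}$, $B_{7}=\{5, 6\}$, $B_{8}=\{6, 7\}$, $B_{9}=\{5, 6, 7, 8\}$, $B_{10}=\{5, 11\}$, $B_{11}=\{5, 12\}$, $B_{12}=\{5, 10\}$, $B_{13}=\{1, 8, 9\}$, $B_{14}=\{6, 15\}$, $B_{15}=\{6, 17\}$, $B_{16}=\{4, 5, 9\}$, $B_{17}=\{6, 14\}$, $B_{18}=\{7, 20\}$, $B_{19}=\{3, 6, 9\}$, $B_{20}=\{7, 21\}$, $B_{21}=\{7, 18\}$, $B_{22}=\{2, 7, 9\}$, $B_{23}=\{8, 24\}$, $B_{24}=\{8, 25\}$, $B_{25}=\{8, 23\}$, $B_{26}=\{4, 5, 9, 16\}$, $B_{27}=\{3, 6, 9, 19\}$, $B_{28}=\{2, 7, 9, 22\}$, $B_{29}=\{1, 8, 9, 13\}$. The instance $\mathcal I_3$ of size 58 is: $B_{1}=([8] \setminus \{1\}) \cup \{15, 16\} \cup ([19:50] \setminus \{19, 27, 35, 43\})$, $B_{2}=([8] \setminus \{2\}) \cup \{15, 16\} \cup ([19:50] \setminus \{20, 28,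 36, 44\})$, $B_{3}=([8] \setminus \{3\}) \cup \{13, 14\} \cup ([19:50] \setminus \{21, 29, 37, 45\})$, $B_{4}=([8] \setminus \{4\}) \cup \{13, 14\} \cup ([19:50] \setminus \{22, 30, 38, 46\})$, $B_{5}=([8] \setminus \{5\}) \cup \{11, 12\} \cup ([19:50] \setminus \{23, 31, 39, 47\})$, $B_{6}=([8] \setminus \{6\}) \cup \{11, 12\} \cup ([19:50] \setminus \{24, 32, 40, 48\})$, $B_{7}=([8] \setminus \{7\}) \cup \{9, 10\} \cup ([19:50] \setminus \{25, 33, 41, 49\})$, $B_{8}=([8] \setminus \{8\}) \cup \{9, 10\} \cup ([19:50] \setminus \{26, 34, 42, 50\})$, $B_{9}=[9:16] \setminus \{9\}$, $B_{10}=\{9, 12, 14\}$, $B_{11}=[9:16] \setminus \{11\}$, $B_{12}=\{11, 14, 16\}$, $B_{13}=[9:16] \setminus \{13\}$, $B_{14}=\{13, 10, 16\}$, $B_{15}=[9:16] \setminus \{15\}$, $B_{16}=\{15, 10, 12\}$, $B_{17}=\{18\}$, $B_{18}=\{17\}$, $B_{19}=\{9, 10, 20, 21, 22\}$, $B_{20}=\{9,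 10, 19, 21, 22\}$, $B_{21}=\{9, 10, 22, 23, 24\}$, $B_{22}=\{9, 10, 21, 23, 24\}$, $B_{23}=\{9, 10, 19, 20, 24\}$, $B_{24}=\{9, 10, 19, 20, 23\}$, $B_{25}=\{1, 2, 15, 16, 17, 18, 26\}$, $B_{26}=\{1, 2, 15, 16, 17, 18, 25\}$, $B_{27}=\{11, 12, 28, 29, 30\}$, $B_{28}=\{11, 12, 27, 29, 30\}$, $B_{29}=\{11, 12, 30, 33, 34\}$, $B_{30}=\{11, 12, 29, 33, 34\}$, $B_{31}=\{7, 8, 9, 10, 17, 18, 32\}$, $B_{32}=\{7, 8, 9, 10, 17, 18, 31\}$, $B_{33}=\{11, 12, 27, 28, 34\}$, $B_{34}=\{11, 12, 27, 28, 33\}$, $B_{35}=\{13, 14, 36, 39, 40\}$, $B_{36}=\{13, 14, 35, 39, 40\}$, $B_{37}=\{5, 6, 11, 12, 17, 18, 38\}$, $B_{38}=\{5, 6, 11, 12, 17, 18, 37\}$, $B_{39}=\{13, 14, 40, 41, 42\}$, $B_{40}=\{13, 14, 39, 41, 42\}$, $B_{41}=\{13, 14, 35, 36, 42\}$, $B_{42}=\{13,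 14, 35, 36, 41\}$, $B_{43}=\{3, 4, 13, 14, 17, 18, 44\}$, $B_{44}=\{3, 4, 13, 14, 17, 18, 43\}$, $B_{45}=\{15, 16, 46, 47, 48\}$, $B_{46}=\{15, 16, 45, 47, 48\}$, $B_{47}=\{15, 16, 48, 49, 50\}$, $B_{48}=\{15, 16, 47, 49, 50\}$, $B_{49}=\{15, 16, 45, 46, 50\}$, $B_{50}=\{15, 16, 45, 46, 49\}$, $B_{51}=\{7, 8, 9, 10, 17, 18, 31, 32, 52\}$, $B_{52}=\{7, 8, 9, 10, 17, 18, 31, 32, 51\}$, $B_{53}=\{5, 6, 11, 12, 17, 18, 37, 38, 54\}$, $B_{54}=\{5, 6, 11, 12, 17, 18, 37, 38, 53\}$, $B_{55}=\{3, 4, 13, 14, 17, 18, 43, 44, 56\}$, $B_{56}=\{3, 4, 13, 14, 17, 18, 43, 44, 55\}$, $B_{57}=\{1, 2, 15, 16, 17, 18, 25, 26, 58\}$, $B_{58}=\{1, 2, 15, 16, 17, 18, 25, 26, 57\}$. **Theorem 1.** Let $\mathcal I=\mathcal I_1\nleftrightarrow\mathcal I_3$, and let $\mathcal I'=(\mathcal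 I_1\nleftrightarrow\mathcal I_a)\leftrightarrow\mathcal I_3$, where $\mathcal I_a$ is any acyclic instance of size 4 (such instances exist). These have sizes 87 and 91, and linear coding is insufficient for achieving their broadcast rates. Precisely: 1. $\beta(\mathcal I)=12$ and $\beta(\mathcal I')=8$, over every finite alphabet with at least two elements. 2. There are a $(1,12)$ index code for $\mathcal I$ and a $(1,8)$ index code for $\mathcal I'$ over the alphabet $GF(3)$ with nonlinear encoders; so these codes achieve the rates 12 and 8. 3. $\lambda_{\mathbb F}(\mathcal I)>12$ and $\lambda_{\mathbb F}(\mathcal I')>8$ for every field $\mathbb F$, and moreover $\lambda(\mathcal I)>12$ and $\lambda(\mathcal I')>8$. -/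

import Mathlib

namespace IndexCoding

/-- A unicast index coding instance whose messages (equivalently, users) are indexed by `ι`:
user `i` requests message `i`, and `B i` is the set of its interfering messages, that is, the
messages other than `i` which it does not know a priori. -/
structure Instance (ι : Type) where
  B : ι → Finset ι
  not_mem_B : ∀ i, i ∉ B i

namespace Instance

/-- The size of an instance: the number of its messages. -/
def size {ι : Type} [Fintype ι] (_I : Instance ι) : ℕ := Fintype.card ι

/-- The index set of the side information of user `i`, the complement of `B i ∪ {i}`. -/
def sideInfo {ι : Type} [Fintype ι] [DecidableEq ι] (I : Instance ι) (i : ι) : Finset ι :=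
  Finset.univ \ insert i (I.B i)

/-- `M` is a minimal cyclic set: its elements can be enumerated cyclically, without repetition,
as `c 0, …, c (n - 1)` with `n ≥ 2`, such that inside `M` the interfering messages of `c j` are
all elements other than `c j` and `c (j + 1)` (`j + 1` is computed modulo `n`). -/
def IsMinimalCyclicSet {ι : Type} [DecidableEq ι] (I : Instance ι) (M : Finset ι) : Prop :=
  ∃ (k : ℕ) (c : Fin (k + 2) → ι), Function.Injective c ∧ Finset.univ.image c = M ∧
    ∀ j, I.B (c j) ∩ M = M \ {c j, c (j + 1)}

/-- `M` is an acyclic set: no subset of it is a minimal cyclic set. -/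
def IsAcyclicSet {ι : Type} [DecidableEq ι] (I : Instance ι) (M : Finset ι) : Prop :=
  ∀ M' ⊆ M, ¬ I.IsMinimalCyclicSet M'

/-- An instance is acyclic if the set of all its messages is an acyclic set. -/
def IsAcyclic {ι : Type} [Fintype ι] [DecidableEq ι] (I : Instance ι) : Prop :=
  I.IsAcyclicSet Finset.univ

/-- No-way connection: every message of each subinstance interferes at every user of the other. -/
def noWay {ι κ : Type} [Fintype ι] [Fintype κ] (I : Instance ι) (J : Instance κ) :
    Instance (ι ⊕ κ) where
  B := Sum.elim (fun i => (I.B i).disjSum Finset.univ) (fun k => Finset.univ.disjSum (J.B k))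
  not_mem_B := by
    rintro (i | k)
    · simpa using I.not_mem_B i
    · simpa using J.not_mem_B k

/-- Two-way connection: every message of each subinstance is known to every user of the other. -/
def twoWay {ι κ : Type} (I : Instance ι) (J : Instance κ) : Instance (ι ⊕ κ) where
  B := Sum.elim (fun i => (I.B i).disjSum ∅) (fun k => Finset.disjSum ∅ (J.B k))
  not_mem_B := by
    rintro (i | k)
    · simpa using I.not_mem_B i
    · simpa using J.not_mem_B k

/-- The instance of size `m` given by a table of interfering message sets in which the messages
carry the numbers `1, …, m`; the element `i` of `Fin m` stands for message number `i + 1`. -/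
def ofTable (m : ℕ) (T : ℕ → Finset ℕ) (hT : ∀ i : Fin m, i.val + 1 ∉ T (i.val + 1)) :
    Instance (Fin m) where
  B i := Finset.univ.filter fun j => j.val + 1 ∈ T (i.val + 1)
  not_mem_B i := by simpa using hT i

end Instance

/-- A `(t, r)` index code for `I` over the alphabet `X`: each message is a word of length `t`, the
broadcast is a word of length `r`, and every user recovers its message from the broadcast and
its side information. -/
structure IndexCode {ι : Type} [Fintype ι] [DecidableEq ι] (I : Instance ι) (X : Type)
    (t r : ℕ) where
  encode : (ι → Fin t → X) → Fin r → X
  decode : (i : ι) → (Fin r → X) → ({l // l ∈ I.sideInfo i} → Fin t → X) → Fin t → X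
  correct : ∀ (x : ι → Fin t → X) (i : ι), decode i (encode x) (fun l => x l.1) = x i

/-- The broadcast rate of `I` over the alphabet `X`: the infimum of `r / t` over all `(t, r)` index
codes with `t ≥ 1`. -/
noncomputable def broadcastRate {ι : Type} [Fintype ι] [DecidableEq ι] (X : Type)
    (I : Instance ι) : ℝ :=
  sInf {ρ : ℝ | ∃ t r : ℕ, 0 < t ∧ Nonempty (IndexCode I X t r) ∧ ρ = (r : ℝ) / (t : ℝ)}

/-- A `(t, r)` linear index code for `I` over the field `F`: `H i` is the local encoding matrix of
message `i`, the broadcast is `∑ i, H i *ᵥ x i`, and the decoders are linear. -/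
structure LinearIndexCode {ι : Type} [Fintype ι] [DecidableEq ι] (I : Instance ι) (F : Type)
    [Field F] (t r : ℕ) where
  H : ι → Matrix (Fin r) (Fin t) F
  decode : (i : ι) →
    ((Fin r → F) × ({l // l ∈ I.sideInfo i} → Fin t → F)) →ₗ[F] (Fin t → F)
  correct : ∀ (x : ι → Fin t → F) (i : ι),
    decode i (∑ j, (H j).mulVec (x j), fun l => x l.1) = x i

/-- The linear broadcast rate of `I` over the field `F`: the infimum of `r / t` over all `(t, r)`
linear index codes with `t ≥ 1`. -/
noncomputable def linearBroadcastRateOver {ι : Type} [Fintype ι] [DecidableEq ι] (F : Type)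
    [Field F] (I : Instance ι) : ℝ :=
  sInf {ρ : ℝ | ∃ t r : ℕ, 0 < t ∧ Nonempty (LinearIndexCode I F t r) ∧ ρ = (r : ℝ) / (t : ℝ)}

/-- The linear broadcast rate of `I`: the infimum of its linear broadcast rates over all finite
fields. -/
noncomputable def linearBroadcastRate {ι : Type} [Fintype ι] [DecidableEq ι]
    (I : Instance ι) : ℝ :=
  sInf {ρ : ℝ | ∃ (F : Type) (_ : Field F) (_ : Finite F), ρ = linearBroadcastRateOver F I}

/-- The interfering message sets of the instance `I₁`, for messages numbered `1, …, 29`. -/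
def table₁ : ℕ → Finset ℕ
  | 1 => (Finset.Icc 1 4 \ {1}) ∪ {8} ∪ (Finset.Icc 10 25 \ {10, 14, 18, 22})
  | 2 => (Finset.Icc 1 4 \ {2}) ∪ {7} ∪ (Finset.Icc 10 25 \ {11, 15, 19, 23})
  | 3 => (Finset.Icc 1 4 \ {3}) ∪ {6} ∪ (Finset.Icc 10 25 \ {12, 16, 20, 24})
  | 4 => (Finset.Icc 1 4 \ {4}) ∪ {5} ∪ (Finset.Icc 10 25 \ {13, 17, 21, 25})
  | 5 => {7, 8}
  | 6 => {5, 8}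
  | 7 => {5, 6}
  | 8 => {6, 7}
  | 9 => {5, 6, 7, 8}
  | 10 => {5, 11}
  | 11 => {5, 12}
  | 12 => {5, 10}
  | 13 => {1, 8, 9}
  | 14 => {6, 15}
  | 15 => {6, 17}
  | 16 => {4, 5, 9}
  | 17 => {6, 14}
  | 18 => {7, 20}
  | 19 => {3, 6, 9}
  | 20 => {7, 21}
  | 21 => {7, 18}
  | 22 => {2, 7, 9}
  | 23 => {8, 24}
  | 24 => {8, 25}
  | 25 => {8, 23}
  | 26 => {4, 5, 9, 16}
  | 27 => {3, 6, 9, 19}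
  | 28 => {2, 7, 9, 22}
  | 29 => {1, 8, 9, 13}
  | _ => ∅

/-- The interfering message sets of the instance `I₃`, for messages numbered `1, …, 58`. -/
def table₃ : ℕ → Finset ℕ
  | 1 => (Finset.Icc 1 8 \ {1}) ∪ {15, 16} ∪ (Finset.Icc 19 50 \ {19, 27, 35, 43})
  | 2 => (Finset.Icc 1 8 \ {2}) ∪ {15, 16} ∪ (Finset.Icc 19 50 \ {20, 28, 36, 44})
  | 3 => (Finset.Icc 1 8 \ {3}) ∪ {13, 14} ∪ (Finset.Icc 19 50 \ {21, 29, 37, 45})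
  | 4 => (Finset.Icc 1 8 \ {4}) ∪ {13, 14} ∪ (Finset.Icc 19 50 \ {22, 30, 38, 46})
  | 5 => (Finset.Icc 1 8 \ {5}) ∪ {11, 12} ∪ (Finset.Icc 19 50 \ {23, 31, 39, 47})
  | 6 => (Finset.Icc 1 8 \ {6}) ∪ {11, 12} ∪ (Finset.Icc 19 50 \ {24, 32, 40, 48})
  | 7 => (Finset.Icc 1 8 \ {7}) ∪ {9, 10} ∪ (Finset.Icc 19 50 \ {25, 33, 41, 49})
  | 8 => (Finset.Icc 1 8 \ {8}) ∪ {9, 10} ∪ (Finset.Icc 19 50 \ {26, 34, 42, 50})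
  | 9 => Finset.Icc 9 16 \ {9}
  | 10 => {9, 12, 14}
  | 11 => Finset.Icc 9 16 \ {11}
  | 12 => {11, 14, 16}
  | 13 => Finset.Icc 9 16 \ {13}
  | 14 => {13, 10, 16}
  | 15 => Finset.Icc 9 16 \ {15}
  | 16 => {15, 10, 12}
  | 17 => {18}
  | 18 => {17}
  | 19 => {9, 10, 20, 21, 22}
  | 20 => {9, 10, 19, 21, 22}
  | 21 => {9, 10, 22, 23, 24}
  | 22 => {9, 10, 21, 23, 24}
  | 23 => {9, 10, 19, 20, 24}
  | 24 => {9, 10, 19, 20, 23}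
  | 25 => {1, 2, 15, 16, 17, 18, 26}
  | 26 => {1, 2, 15, 16, 17, 18, 25}
  | 27 => {11, 12, 28, 29, 30}
  | 28 => {11, 12, 27, 29, 30}
  | 29 => {11, 12, 30, 33, 34}
  | 30 => {11, 12, 29, 33, 34}
  | 31 => {7, 8, 9, 10, 17, 18, 32}
  | 32 => {7, 8, 9, 10, 17, 18, 31}
  | 33 => {11, 12, 27, 28, 34}
  | 34 => {11, 12, 27, 28, 33}
  | 35 => {13, 14, 36, 39, 40}
  | 36 => {13, 14, 35, 39, 40}
  | 37 => {5, 6, 11, 12, 17, 18, 38}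
  | 38 => {5, 6, 11, 12, 17, 18, 37}
  | 39 => {13, 14, 40, 41, 42}
  | 40 => {13, 14, 39, 41, 42}
  | 41 => {13, 14, 35, 36, 42}
  | 42 => {13, 14, 35, 36, 41}
  | 43 => {3, 4, 13, 14, 17, 18, 44}
  | 44 => {3, 4, 13, 14, 17, 18, 43}
  | 45 => {15, 16, 46, 47, 48}
  | 46 => {15, 16, 45, 47, 48}
  | 47 => {15, 16, 48, 49, 50}
  | 48 => {15, 16, 47, 49, 50}
  | 49 => {15, 16, 45, 46, 50}
  | 50 => {15, 16, 45, 46, 49}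
  | 51 => {7, 8, 9, 10, 17, 18, 31, 32, 52}
  | 52 => {7, 8, 9, 10, 17, 18, 31, 32, 51}
  | 53 => {5, 6, 11, 12, 17, 18, 37, 38, 54}
  | 54 => {5, 6, 11, 12, 17, 18, 37, 38, 53}
  | 55 => {3, 4, 13, 14, 17, 18, 43, 44, 56}
  | 56 => {3, 4, 13, 14, 17, 18, 43, 44, 55}
  | 57 => {1, 2, 15, 16, 17, 18, 25, 26, 58}
  | 58 => {1, 2, 15, 16, 17, 18, 25, 26, 57}
  | _ => ∅

/-- The index coding instance `I₁` of size 29. -/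
def I₁ : Instance (Fin 29) := Instance.ofTable 29 table₁ (by decide)

/-- The index coding instance `I₃` of size 58. -/
def I₃ : Instance (Fin 58) := Instance.ofTable 58 table₃ (by decide)

end IndexCoding

open IndexCoding

/-!
The pairwise interfering messages `1, …, 4` of `I₁` and `1, …, 8` of `I₃` force every code to
broadcast at least four and eight messages, respectively, and the no-way connection adds these
numbers, whereas the two-way connection takes the maximum. Codes of these rates exist over the
alphabet `GF(3)`; the broadcast rate does not depend on the alphabet (`broadcastRate_eq`).

The instance `I₁` is tailored to characteristic three. In a linear code of dimension exactly four,
messages `1, …, 4` are encoded by a basis `e₁, …, e₄`, message `9` can be normalized to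
`e₁ + e₂ + e₃ + e₄`, and the messages `5, …, 8` to this sum without one of its terms. The sum of the
encodings of `5, …, 8` is three times that of message `9`, and user `9` requires the latter not to be
in the span of the former. So `3 = 0`. The instance `I₃` has the same structure with each message
doubled, but user `9` now requires that half of the pair `(9, 10)` can be told from all messages
`10, …, 16`, which is impossible if the four pairs have the sum zero. A linear code must therefore
have `3 ≠ 0`. A nonlinear code over `GF(3)` may read a pair as an integer modulo nine instead
(`encode₃`). From the four sums without one term, three times each pair can be computed without
knowing the other pairs. Over `GF(3)` this is zero, but modulo nine it reveals the lower digit, which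
is the first message of the pair.

Since the linear broadcast rate is an infimum, the impossibility must be shown with a margin. If the
broadcast space has dimension `4 * d + D`, where `d` is the dimension of a message (or of a pair),
every relation above holds up to subspaces of codimension a small multiple of `D`
(`exists_block_coordinates`). This gives `D ≥ d / 8` for `I₁` when `3 ≠ 0` (`I₁_bound`) and, for `t`
the dimension of one message, `D ≥ t / 11` for `I₃` when `3 = 0` (`I₃_bound`). The margins are the
same for all fields. A solution of a no-way connection splits into solutions of its parts
(`exists_noWay_split`), and an acyclic instance of size four always takes four dimensions, so that
both connections inherit the margin.
-/

namespace IndexCoding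

/-! ### Dimension estimates -/

section LinearAlgebra

open Module

variable {F V W : Type*} [Field F] [AddCommGroup V] [Module F V] [AddCommGroup W] [Module F W]

/-- Imposing on the vectors `x` of `X` the condition `f x ∈ S` lowers the dimension by at most
`dim T - dim S`, where `T` is any space containing `S` and `f '' X`. -/
theorem finrank_add_finrank_le_inf_comap [FiniteDimensional F V] [FiniteDimensional F W]
    (f : V →ₗ[F] W) {X : Submodule F V} {S T : Submodule F W} (hST : S ≤ T)
    (hX : X.map f ≤ T) :
    finrank F X + finrank F S ≤ finrank F ↥(X ⊓ S.comap f) + finrank F T := by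
  have h₁ := (S.mkQ ∘ₗ f ∘ₗ X.subtype).finrank_range_add_finrank_ker
  have h₂ := (S.mkQ ∘ₗ T.subtype).finrank_range_add_finrank_ker
  have hk₁ : LinearMap.ker (S.mkQ ∘ₗ f ∘ₗ X.subtype) = (X ⊓ S.comap f).comap X.subtype := by
    ext x; simp
  have hk₂ : LinearMap.ker (S.mkQ ∘ₗ T.subtype) = S.comap T.subtype := by
    ext x; simp
  rw [hk₁, (Submodule.comapSubtypeEquivOfLe inf_le_left).finrank_eq] at h₁
  rw [hk₂, (Submodule.comapSubtypeEquivOfLe hST).finrank_eq] at h₂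
  have h₃ : finrank F (LinearMap.range (S.mkQ ∘ₗ f ∘ₗ X.subtype)) ≤
      finrank F (LinearMap.range (S.mkQ ∘ₗ T.subtype)) := by
    apply Submodule.finrank_mono
    rintro _ ⟨x, rfl⟩
    exact ⟨⟨f x, hX ⟨x, x.2, rfl⟩⟩, rfl⟩
  omega

theorem finrank_add_finrank_le_comap [FiniteDimensional F V] [FiniteDimensional F W]
    (f : V →ₗ[F] W) (S : Submodule F W) :
    finrank F V + finrank F S ≤
      finrank F (S.comap f) + finrank F ↥(LinearMap.range f ⊔ S) := by
  have h := finrank_add_finrank_le_inf_comap f (X := ⊤) (S := S)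
    (T := LinearMap.range f ⊔ S) le_sup_right (by rw [Submodule.map_top]; exact le_sup_left)
  rwa [top_inf_eq, finrank_top] at h

theorem finrank_add_finrank_le_inf [FiniteDimensional F V] (X Y : Submodule F V) :
    finrank F X + finrank F Y ≤ finrank F ↥(X ⊓ Y) + finrank F V := by
  have h := Submodule.finrank_sup_add_finrank_inf_eq X Y
  have := (X ⊔ Y).finrank_le
  omega

/-- If the ranges of `P 0, …, P 3` span a space of the largest possible dimension, then their sum
is direct. -/
theorem eq_zero_of_sum_eq_zero [FiniteDimensional F V] [FiniteDimensional F W]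
    {P : Fin 4 → V →ₗ[F] W}
    (hP : 4 * finrank F V ≤ finrank F ↥(⨆ k, LinearMap.range (P k)))
    {z : Fin 4 → V} (hz : ∑ k, P k (z k) = 0) : z = 0 := by
  have h := (LinearMap.lsum F (fun _ : Fin 4 => V) F P).finrank_range_add_finrank_ker
  have hr : LinearMap.range (LinearMap.lsum F (fun _ : Fin 4 => V) F P) =
      ⨆ k, LinearMap.range (P k) := by
    apply le_antisymm
    · rintro _ ⟨z, rfl⟩
      simp only [LinearMap.lsum_apply, LinearMap.sum_apply, LinearMap.comp_apply,
        LinearMap.proj_apply]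
      exact Submodule.sum_mem _ fun k _ => Submodule.mem_iSup_of_mem k ⟨_, rfl⟩
    · refine iSup_le fun k => ?_
      rintro _ ⟨v, rfl⟩
      exact ⟨Pi.single k v, LinearMap.lsum_piSingle ..⟩
  rw [hr, finrank_pi_fintype] at h
  simp only [Finset.sum_const, Finset.card_univ, Fintype.card_fin, smul_eq_mul] at h
  have hk : finrank F (LinearMap.ker (LinearMap.lsum F (fun _ : Fin 4 => V) F P)) = 0 := by omega
  rw [Submodule.finrank_eq_zero] at hk
  have : z ∈ LinearMap.ker (LinearMap.lsum F (fun _ : Fin 4 => V) F P) := by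
    simpa [LinearMap.lsum_apply] using hz
  rwa [hk, Submodule.mem_bot] at this

theorem mem_iSup_range_ne {P : Fin 4 → V →ₗ[F] W} {k : Fin 4} {w : W}
    (hw : w ∈ ⨆ j, ⨆ (_ : j ≠ k), LinearMap.range (P j)) :
    ∃ z : Fin 4 → V, z k = 0 ∧ w = ∑ j, P j (z j) := by
  induction hw using Submodule.iSup_induction' with
  | zero => exact ⟨0, rfl, by simp⟩
  | add x y _ _ hx hy =>
    obtain ⟨z, hz, rfl⟩ := hx
    obtain ⟨z', hz', rfl⟩ := hy
    exact ⟨z + z', by simp [hz, hz'], by simp [Finset.sum_add_distrib]⟩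
  | mem j x hx =>
    by_cases hj : j = k
    · simp only [hj, ne_eq, not_true_eq_false, iSup_false, Submodule.mem_bot] at hx
      exact ⟨0, rfl, by simp [hx]⟩
    · simp only [ne_eq, hj, not_false_eq_true, iSup_true] at hx
      obtain ⟨v, rfl⟩ := hx
      refine ⟨Pi.single j v, Pi.single_eq_of_ne (Ne.symm hj) _, ?_⟩
      rw [Finset.sum_eq_single j] <;> simp +contextual

theorem three_mul_finrank_le [FiniteDimensional F V] [FiniteDimensional F W]
    {P : Fin 4 → V →ₗ[F] W}
    (hP : 4 * finrank F V ≤ finrank F ↥(⨆ k, LinearMap.range (P k))) (k : Fin 4) :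
    3 * finrank F V ≤ finrank F ↥(⨆ j, ⨆ (_ : j ≠ k), LinearMap.range (P j)) := by
  have h₁ : ⨆ j, LinearMap.range (P j) ≤
      LinearMap.range (P k) ⊔ ⨆ j, ⨆ (_ : j ≠ k), LinearMap.range (P j) := by
    refine iSup_le fun j => ?_
    by_cases hj : j = k
    · subst hj; exact le_sup_left
    · exact le_sup_of_le_right (le_iSup₂_of_le j hj le_rfl)
  have h₂ := Submodule.finrank_mono h₁
  have h₃ := Submodule.finrank_add_le_finrank_add_finrank (LinearMap.range (P k))
    (⨆ j, ⨆ (_ : j ≠ k), LinearMap.range (P j))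
  have h₄ := (P k).finrank_range_le
  omega

/-- The configuration common to both instances. The ranges of `P 0, …, P 3` are independent, `m k`
nearly takes its values in the sum of the `P j` with `j ≠ k`, and `n` nearly takes its values in
the sum of `P k` and `m k`; here "nearly" is measured by the defect `D`. Then on a space of
codimension at most `8 * D` the vector `n x` has coordinates `z k` such that all the differences
`n x - P k (z k)` lie in the ranges of the `m k`. -/
theorem exists_block_coordinates [FiniteDimensional F V] [FiniteDimensional F W] {D : ℕ}
    {P m : Fin 4 → V →ₗ[F] W} {n : V →ₗ[F] W}
    (hP : 4 * finrank F V ≤ finrank F ↥(⨆ k, LinearMap.range (P k)))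
    (hm : ∀ k, finrank F ↥(LinearMap.range (m k) ⊔ ⨆ j, ⨆ (_ : j ≠ k), LinearMap.range (P j)) ≤
      3 * finrank F V + D)
    (hPm : ∀ k, 2 * finrank F V ≤ finrank F ↥(LinearMap.range (P k) ⊔ LinearMap.range (m k)))
    (hn : ∀ k, finrank F
      ↥(LinearMap.range n ⊔ (LinearMap.range (P k) ⊔ LinearMap.range (m k))) ≤
        2 * finrank F V + D) :
    ∃ X : Submodule F V, finrank F V ≤ finrank F X + 8 * D ∧ ∀ x ∈ X, ∃ z u : Fin 4 → V,
      n x = ∑ j, P j (z j) ∧ ∀ k, n x = P k (z k) + m k (u k) := by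
  set T : Fin 4 → Submodule F W := fun k => ⨆ j, ⨆ (_ : j ≠ k), LinearMap.range (P j)
  set S : Fin 4 → Submodule F W := fun k =>
    LinearMap.range (P k) ⊔ ((T k).comap (m k)).map (m k)
  have hX : ∀ k, finrank F V ≤ finrank F ((S k).comap n) + 2 * D := by
    intro k
    have h₁ := finrank_add_finrank_le_comap (m k) (T k)
    have h₂ : 3 * finrank F V ≤ finrank F (T k) := three_mul_finrank_le hP k
    have h₃ : finrank F ↥(LinearMap.range (m k) ⊔ T k) ≤ 3 * finrank F V + D := hm k
    have h₄ := hn k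
    have h₅ := hPm k
    have h₆ : finrank F ↥(LinearMap.range (P k) ⊔ LinearMap.range (m k)) ≤
        finrank F (S k) + D := by
      have h₇ := (m k).finrank_range_add_finrank_ker
      have h₈ := ((m k).domRestrict ((T k).comap (m k))).finrank_range_add_finrank_ker
      have h₉ : finrank F (LinearMap.ker ((m k).domRestrict ((T k).comap (m k)))) =
          finrank F (LinearMap.ker (m k)) := by
        have hle : LinearMap.ker (m k) ≤ (T k).comap (m k) := by
          intro x hx
          rw [LinearMap.mem_ker] at hx
          simp [hx]
        rw [LinearMap.ker_domRestrict]
        exact (Submodule.comapSubtypeEquivOfLe hle).finrank_eq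
      rw [LinearMap.range_domRestrict] at h₈
      have h₁₀ := Submodule.finrank_sup_add_finrank_inf_eq (LinearMap.range (P k))
        (LinearMap.range (m k))
      have h₁₁ : finrank F (S k) +
          finrank F ↥(LinearMap.range (P k) ⊓ ((T k).comap (m k)).map (m k)) = _ :=
        Submodule.finrank_sup_add_finrank_inf_eq _ _
      have h₁₂ : finrank F ↥(LinearMap.range (P k) ⊓ ((T k).comap (m k)).map (m k)) ≤
          finrank F ↥(LinearMap.range (P k) ⊓ LinearMap.range (m k)) :=
        Submodule.finrank_mono (inf_le_inf_left _ LinearMap.map_le_range)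
      omega
    have h₁₃ := finrank_add_finrank_le_comap n (S k)
    have h₁₄ : finrank F ↥(LinearMap.range n ⊔ S k) ≤ finrank F
        ↥(LinearMap.range n ⊔ (LinearMap.range (P k) ⊔ LinearMap.range (m k))) :=
      Submodule.finrank_mono (sup_le_sup_left (sup_le_sup_left LinearMap.map_le_range _) _)
    omega
  refine ⟨((S 0).comap n ⊓ (S 1).comap n) ⊓ ((S 2).comap n ⊓ (S 3).comap n), ?_, ?_⟩
  · have h₁ := finrank_add_finrank_le_inf ((S 0).comap n) ((S 1).comap n)
    have h₂ := finrank_add_finrank_le_inf ((S 2).comap n) ((S 3).comap n)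
    have h₃ := finrank_add_finrank_le_inf ((S 0).comap n ⊓ (S 1).comap n)
      ((S 2).comap n ⊓ (S 3).comap n)
    have := hX 0
    have := hX 1
    have := hX 2
    have := hX 3
    omega
  · intro x hx
    have hx' : ∀ k, n x ∈ S k := by
      simp only [Submodule.mem_inf, Submodule.mem_comap] at hx
      intro k
      fin_cases k
      exacts [hx.1.1, hx.1.2, hx.2.1, hx.2.2]
    have hyu : ∀ k, ∃ (y u : V) (z : Fin 4 → V), z k = y ∧ n x = P k y + m k u ∧
        n x = ∑ j, P j (z j) := by
      intro k
      obtain ⟨_, ⟨y, rfl⟩, _, ⟨u, hu, rfl⟩, h⟩ := Submodule.mem_sup.1 (hx' k)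
      obtain ⟨z, hz, hz'⟩ := mem_iSup_range_ne (Submodule.mem_comap.1 hu)
      refine ⟨y, u, z + Pi.single k y, by simp [hz], h.symm, ?_⟩
      simp only [Pi.add_apply, map_add, Finset.sum_add_distrib, ← hz']
      rw [Finset.sum_eq_single k (by simp +contextual) (by simp), ← h]
      simp [add_comm]
    choose y u z hzy hn' hsum using hyu
    -- The coordinates of `n x` with respect to the independent ranges of the `P j` are unique.
    have huniq : ∀ k, z k = z 0 := by
      intro k
      rw [← sub_eq_zero]
      apply eq_zero_of_sum_eq_zero hP
      simp [Finset.sum_sub_distrib, ← hsum]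
    refine ⟨z 0, u, hsum 0, fun k => ?_⟩
    rw [hn' k, ← hzy k, huniq k]

end LinearAlgebra

/-! ### Linear index codes as independence conditions -/

section LinearSolutions

open Module

variable {F V W : Type*} [Field F] [AddCommGroup V] [Module F V] [AddCommGroup W] [Module F W]
variable {ι κ : Type}

/-- The subspace of the broadcast space `W` spanned by the encodings of the messages in `A`. -/
def messageSpan (h : ι → V →ₗ[F] W) (A : Finset ι) : Submodule F W :=
  ⨆ j ∈ A, LinearMap.range (h j)

/-- A linear index code in coordinate-free form: the messages are vectors of `V`, message `i` is
encoded by `h i`, and the broadcast is the sum of the encodings. User `i` can decode exactly if no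
nonzero encoding of message `i` lies in the span of the interfering messages (and `h i` is
injective). -/
def IsLinearSolution (I : Instance ι) (h : ι → V →ₗ[F] W) : Prop :=
  ∀ i v, h i v ∈ messageSpan h (I.B i) → v = 0

theorem messageSpan_insert [DecidableEq ι] (h : ι → V →ₗ[F] W) (i : ι) (A : Finset ι) :
    messageSpan h (insert i A) = LinearMap.range (h i) ⊔ messageSpan h A :=
  Finset.iSup_insert i A _

theorem messageSpan_singleton (h : ι → V →ₗ[F] W) (i : ι) :
    messageSpan h {i} = LinearMap.range (h i) :=
  Finset.iSup_singleton i _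

theorem messageSpan_union [DecidableEq ι] (h : ι → V →ₗ[F] W) (A B : Finset ι) :
    messageSpan h (A ∪ B) = messageSpan h A ⊔ messageSpan h B :=
  Finset.iSup_union

theorem messageSpan_mono (h : ι → V →ₗ[F] W) {A B : Finset ι} (hAB : A ⊆ B) :
    messageSpan h A ≤ messageSpan h B :=
  biSup_mono fun _ hi => hAB hi

theorem mem_messageSpan (h : ι → V →ₗ[F] W) {A : Finset ι} {i : ι} (hi : i ∈ A) (v : V) :
    h i v ∈ messageSpan h A :=
  Submodule.mem_iSup_of_mem i (Submodule.mem_iSup_of_mem hi ⟨v, rfl⟩)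

namespace IsLinearSolution

variable {I : Instance ι} {h : ι → V →ₗ[F] W}

theorem injective (hI : IsLinearSolution I h) (i : ι) : Function.Injective (h i) := by
  rw [injective_iff_map_eq_zero]
  exact fun v hv => hI i v (hv ▸ Submodule.zero_mem _)

/-- A message all of whose companions interfere at its user contributes its full dimension. -/
theorem finrank_insert [DecidableEq ι] [FiniteDimensional F W] (hI : IsLinearSolution I h)
    {i : ι} {A : Finset ι} (hA : A ⊆ I.B i) :
    finrank F (messageSpan h (insert i A)) = finrank F V + finrank F (messageSpan h A) := by
  have hinf : LinearMap.range (h i) ⊓ messageSpan h A = ⊥ := by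
    rw [eq_bot_iff]
    rintro _ ⟨⟨v, rfl⟩, hv⟩
    rw [hI i v (messageSpan_mono h hA hv)]
    simp
  have := Submodule.finrank_sup_add_finrank_inf_eq (LinearMap.range (h i)) (messageSpan h A)
  rw [hinf, finrank_bot, LinearMap.finrank_range_of_inj (hI.injective i)] at this
  rw [messageSpan_insert]
  exact this

theorem finrank_singleton [FiniteDimensional F W] (hI : IsLinearSolution I h) (i : ι) :
    finrank F (messageSpan h {i}) = finrank F V := by
  rw [messageSpan_singleton, LinearMap.finrank_range_of_inj (hI.injective i)]

theorem finrank_add_le [DecidableEq ι] [FiniteDimensional F W] (hI : IsLinearSolution I h)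
    {i : ι} {A : Finset ι} (hA : A ⊆ I.B i) :
    finrank F V + finrank F (messageSpan h A) ≤ finrank F W :=
  hI.finrank_insert hA ▸ Submodule.finrank_le _

theorem finrank_add_add_le [DecidableEq ι] [FiniteDimensional F W] (hI : IsLinearSolution I h)
    {i j : ι} {A : Finset ι} (hi : A ⊆ I.B i) (hj : insert i A ⊆ I.B j) :
    2 * finrank F V + finrank F (messageSpan h A) ≤ finrank F W := by
  have h₁ := hI.finrank_add_le hj
  have h₂ := hI.finrank_insert hi
  omega

/-- A solution of an instance restricts to a solution of any instance that maps into it with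
the interfering messages mapped to interfering messages. -/
theorem restrict (hI : IsLinearSolution I h) {J : Instance κ} {e : κ → ι}
    (he : ∀ k, ∀ l ∈ J.B k, e l ∈ I.B (e k)) : IsLinearSolution J fun k => h (e k) := by
  intro k v hv
  apply hI (e k) v
  refine (iSup₂_le fun l hl => ?_ : messageSpan (fun k => h (e k)) (J.B k) ≤ _) hv
  rintro _ ⟨w, rfl⟩
  exact mem_messageSpan h (he k l hl) w

theorem twoWay_left {J : Instance κ} {h : ι ⊕ κ → V →ₗ[F] W}
    (hIJ : IsLinearSolution (I.twoWay J) h) : IsLinearSolution I fun i => h (.inl i) :=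
  hIJ.restrict fun k l hl => by simpa [Instance.twoWay] using hl

theorem twoWay_right {J : Instance κ} {h : ι ⊕ κ → V →ₗ[F] W}
    (hIJ : IsLinearSolution (I.twoWay J) h) : IsLinearSolution J fun k => h (.inr k) :=
  hIJ.restrict fun k l hl => by simpa [Instance.twoWay] using hl

theorem noWay_right [Fintype ι] [Fintype κ] {J : Instance κ} {h : ι ⊕ κ → V →ₗ[F] W}
    (hIJ : IsLinearSolution (I.noWay J) h) :
    IsLinearSolution J fun k => (h (.inr k)).codRestrict
      (⨆ k, LinearMap.range (h (.inr k))) fun v => Submodule.mem_iSup_of_mem k ⟨v, rfl⟩ := by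
  intro k v hv
  apply hIJ (.inr k) v
  have h₁ := Submodule.mem_map_of_mem (f := Submodule.subtype _) hv
  refine (?_ : Submodule.map _ _ ≤ _) h₁
  rw [messageSpan, Submodule.map_iSup, iSup_le_iff]
  intro l
  rw [Submodule.map_iSup, iSup_le_iff]
  rintro hl _ ⟨_, ⟨w, rfl⟩, rfl⟩
  exact mem_messageSpan h (by simpa [Instance.noWay] using hl) w

theorem noWay_left [Fintype ι] [Fintype κ] {J : Instance κ} {h : ι ⊕ κ → V →ₗ[F] W}
    (hIJ : IsLinearSolution (I.noWay J) h) :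
    IsLinearSolution I fun i =>
      (⨆ k, LinearMap.range (h (.inr k))).mkQ ∘ₗ h (.inl i) := by
  intro i v hv
  apply hIJ (.inl i) v
  have h₁ : (⨆ k, LinearMap.range (h (.inr k))).mkQ (h (.inl i) v) ∈
      (messageSpan h ((I.noWay J).B (.inl i))).map (⨆ k, LinearMap.range (h (.inr k))).mkQ := by
    refine (?_ : messageSpan _ _ ≤ _) hv
    refine iSup₂_le fun l hl => ?_
    rintro _ ⟨w, rfl⟩
    exact ⟨_, mem_messageSpan h (by simpa [Instance.noWay] using hl) w, rfl⟩
  have h₂ : ⨆ k, LinearMap.range (h (.inr k)) ≤ messageSpan h ((I.noWay J).B (.inl i)) := by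
    refine iSup_le fun k => ?_
    rintro _ ⟨w, rfl⟩
    exact mem_messageSpan h (by simp [Instance.noWay]) w
  have h₃ := Submodule.mem_comap.2 h₁
  rwa [Submodule.comap_map_mkQ, sup_eq_right.2 h₂] at h₃

end IsLinearSolution

/-- A lower bound for the dimension of the broadcast space of every linear solution of a no-way
connection follows from lower bounds for the two parts: the encodings of the second part span a
subspace in which the second part is solved, and modulo this subspace the first part is solved. -/
theorem IsLinearSolution.exists_noWay_split [Fintype ι] [Fintype κ] {I : Instance ι}
    {J : Instance κ} [FiniteDimensional F W] {h : ι ⊕ κ → V →ₗ[F] W}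
    (hIJ : IsLinearSolution (I.noWay J) h) :
    ∃ (S : Submodule F W) (h₁ : ι → V →ₗ[F] W ⧸ S) (h₂ : κ → V →ₗ[F] S),
      IsLinearSolution I h₁ ∧ IsLinearSolution J h₂ ∧
        finrank F (W ⧸ S) + finrank F S = finrank F W :=
  ⟨_, _, _, hIJ.noWay_left, hIJ.noWay_right, Submodule.finrank_quotient_add_finrank _⟩

/-- The encoding maps of a linear index code. -/
theorem LinearIndexCode.isLinearSolution {F : Type} [Field F] [Fintype ι] [DecidableEq ι]
    {I : Instance ι} {t r : ℕ} (C : LinearIndexCode I F t r) :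
    IsLinearSolution I fun i => (C.H i).mulVecLin := by
  intro i v hv
  have h₁ : ∀ w ∈ messageSpan (fun i => (C.H i).mulVecLin) (I.B i), ∃ x : ι → Fin t → F,
      (∀ j ∉ I.B i, x j = 0) ∧ w = ∑ j, (C.H j).mulVec (x j) := by
    intro w hw
    induction hw using Submodule.iSup_induction' with
    | zero => exact ⟨0, by simp, by simp⟩
    | add y z _ _ hy hz =>
      obtain ⟨a, ha, rfl⟩ := hy
      obtain ⟨b, hb, rfl⟩ := hz
      refine ⟨a + b, fun j hj => by simp [ha j hj, hb j hj], ?_⟩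
      simp [Matrix.mulVec_add, Finset.sum_add_distrib]
    | mem j y hy =>
      by_cases hj : j ∈ I.B i
      · simp only [hj, iSup_pos] at hy
        obtain ⟨u, rfl⟩ := hy
        refine ⟨Pi.single j u, fun k hk => Pi.single_eq_of_ne (by rintro rfl; exact hk hj) _, ?_⟩
        rw [Finset.sum_eq_single j] <;> simp +contextual
      · simp only [hj, not_false_eq_true, iSup_neg, Submodule.mem_bot] at hy
        exact ⟨0, by simp, by simp [hy]⟩
  obtain ⟨x, hx, hw⟩ := h₁ _ hv
  have hxi : x i = 0 := hx i (I.not_mem_B i)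
  -- The messages `v` at `i` and `- x j` elsewhere are broadcast as zero and look like zero to `i`.
  have h₂ := C.correct (Pi.single i v - x) i
  have h₃ : ∑ j, (C.H j).mulVec ((Pi.single i v - x : ι → Fin t → F) j) = 0 := by
    simp only [Pi.sub_apply, Matrix.mulVec_sub, Finset.sum_sub_distrib, ← hw]
    rw [Finset.sum_eq_single i] <;> simp +contextual
  have h₄ : (fun l : {l // l ∈ I.sideInfo i} => (Pi.single i v - x : ι → Fin t → F) l.1) = 0 := by
    funext ⟨l, hl⟩
    simp only [Instance.sideInfo, Finset.mem_sdiff, Finset.mem_univ, Finset.mem_insert, not_or,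
      true_and] at hl
    simp [hl.1, hx l hl.2]
  rw [h₃, h₄, Prod.mk_zero_zero, map_zero] at h₂
  simpa [hxi] using h₂.symm

end LinearSolutions

/-! ### Lower bounds for linear codes -/

section LinearBounds

open Module

variable {F V W : Type*} [Field F] [AddCommGroup V] [Module F V] [AddCommGroup W] [Module F W]
variable {ι κ : Type}

theorem messageSpan_empty (h : ι → V →ₗ[F] W) : messageSpan h ∅ = ⊥ := by
  simp [messageSpan]

theorem messageSpan_biUnion [DecidableEq ι] {α : Type*} (h : ι → V →ₗ[F] W) (s : Finset α)
    (A : α → Finset ι) : messageSpan h (s.biUnion A) = ⨆ a ∈ s, messageSpan h (A a) :=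
  Finset.iSup_biUnion s A _

theorem iSup_range_eq_messageSpan [DecidableEq ι] {U : Type*} [AddCommGroup U] [Module F U]
    {h : ι → V →ₗ[F] W} {P : Fin 4 → U →ₗ[F] W} {A : Fin 4 → Finset ι}
    (hP : ∀ k, LinearMap.range (P k) = messageSpan h (A k)) :
    ⨆ k, LinearMap.range (P k) = messageSpan h (Finset.univ.biUnion A) := by
  simp [messageSpan_biUnion, hP]

theorem iSup_range_ne_eq_messageSpan [DecidableEq ι] {U : Type*} [AddCommGroup U] [Module F U]
    {h : ι → V →ₗ[F] W} {P : Fin 4 → U →ₗ[F] W} {A : Fin 4 → Finset ι}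
    (hP : ∀ k, LinearMap.range (P k) = messageSpan h (A k)) (k : Fin 4) :
    ⨆ j, ⨆ (_ : j ≠ k), LinearMap.range (P j) =
      messageSpan h ((Finset.univ.erase k).biUnion A) := by
  simp [messageSpan_biUnion, hP]

theorem range_coprod_eq_messageSpan [DecidableEq ι] (h : ι → V →ₗ[F] W) (i j : ι) :
    LinearMap.range ((h i).coprod (h j)) = messageSpan h {i, j} := by
  rw [LinearMap.range_coprod, messageSpan_insert, messageSpan_singleton]

theorem I₁_clique : ∀ a b : Fin 4, a ≠ b →
    (![0, 1, 2, 3] : Fin 4 → Fin 29) b ∈ I₁.B ((![0, 1, 2, 3] : Fin 4 → Fin 29) a) := by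
  decide +kernel

theorem I₃_clique : ∀ a b : Fin 8, a ≠ b → (![0, 1, 2, 3, 4, 5, 6, 7] : Fin 8 → Fin 58) b ∈
    I₃.B ((![0, 1, 2, 3, 4, 5, 6, 7] : Fin 8 → Fin 58) a) := by
  decide +kernel

namespace IsLinearSolution

/-- Messages which pairwise interfere are encoded in independent subspaces. -/
theorem finrank_messageSpan_image [DecidableEq ι] [FiniteDimensional F W] {I : Instance ι}
    {h : ι → V →ₗ[F] W} (hI : IsLinearSolution I h) {c : κ → ι}
    (hc : ∀ a b, a ≠ b → c b ∈ I.B (c a)) (A : Finset κ) :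
    finrank F (messageSpan h (A.image c)) = A.card * finrank F V := by
  classical
  induction A using Finset.induction_on with
  | empty =>
    rw [Finset.image_empty, messageSpan_empty, finrank_bot, Finset.card_empty, zero_mul]
  | insert a A ha ih =>
    rw [Finset.image_insert, hI.finrank_insert, ih, Finset.card_insert_of_notMem ha]
    · ring
    · intro x hx
      obtain ⟨b, hb, rfl⟩ := Finset.mem_image.1 hx
      exact hc a b (by rintro rfl; exact ha hb)

theorem card_mul_finrank_le [Fintype κ] [DecidableEq ι] [FiniteDimensional F W]
    {I : Instance ι} {h : ι → V →ₗ[F] W} (hI : IsLinearSolution I h) {c : κ → ι}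
    (hc : ∀ a b, a ≠ b → c b ∈ I.B (c a)) :
    Fintype.card κ * finrank F V ≤ finrank F W := by
  rw [← Finset.card_univ, ← hI.finrank_messageSpan_image hc]
  exact Submodule.finrank_le _

variable [FiniteDimensional F V] [FiniteDimensional F W]

/-- In characteristic other than three `I₁` needs broadcasts longer than four messages. With `m k`
the encodings of messages `8, 7, 6, 5` and `n` that of message `9`, the coordinates of
`exists_block_coordinates` give `∑ k, m k (u k) = 3 • n x`, whereas user `9` can tell message `9`
from the messages `5, …, 8`. -/
theorem I₁_bound {h : Fin 29 → V →ₗ[F] W} (hI : IsLinearSolution I₁ h) (h3 : (3 : F) ≠ 0) :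
    33 * finrank F V ≤ 8 * finrank F W := by
  have h4 : Fintype.card (Fin 4) * finrank F V ≤ finrank F W :=
    hI.card_mul_finrank_le I₁_clique
  rw [Fintype.card_fin] at h4
  obtain ⟨D, hD⟩ := Nat.exists_eq_add_of_le h4
  let p : Fin 4 → Fin 29 := ![0, 1, 2, 3]
  let q : Fin 4 → Fin 29 := ![7, 6, 5, 4]
  -- The users `13, 22, 19, 16` and `29, 28, 27, 26`.
  let a : Fin 4 → Fin 29 := ![12, 21, 18, 15]
  let c : Fin 4 → Fin 29 := ![28, 27, 26, 25]
  have hP : ∀ k, LinearMap.range (h (p k)) = messageSpan h {p k} :=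
    fun k => (messageSpan_singleton h _).symm
  refine Exists.elim (exists_block_coordinates (D := D) (P := fun k => h (p k))
    (m := fun k => h (q k)) (n := h 8) ?_ ?_ ?_ ?_) fun X ⟨hX, hXz⟩ => ?_
  · rw [iSup_range_eq_messageSpan hP]
    have := hI.finrank_messageSpan_image I₁_clique Finset.univ
    rw [Finset.card_univ, Fintype.card_fin, ← Finset.biUnion_singleton] at this
    exact this.ge
  · intro k
    rw [iSup_range_ne_eq_messageSpan hP, ← messageSpan_insert]
    have := hI.finrank_add_le (i := p k)
      (A := insert (q k) ((Finset.univ.erase k).biUnion fun k => {p k}))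
      (by revert k; decide)
    omega
  · intro k
    rw [← messageSpan_singleton h (q k), ← messageSpan_insert, hI.finrank_insert,
      hI.finrank_singleton]
    · omega
    · revert k; decide
  · intro k
    rw [← messageSpan_singleton h (q k), ← messageSpan_insert, ← messageSpan_insert]
    have := hI.finrank_add_add_le (i := a k) (j := c k) (A := {8, p k, q k})
      (by revert k; decide) (by revert k; decide)
    omega
  · suffices hbot : X = ⊥ by
      rw [hbot, finrank_bot] at hX
      omega
    rw [eq_bot_iff]
    intro x hx
    obtain ⟨z, u, hz, hu⟩ := hXz x hx
    have hsum : ∑ k, h (q k) (u k) = (3 : F) • h 8 x := by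
      have : ∑ k : Fin 4, h 8 x = ∑ k, (h (p k) (z k) + h (q k) (u k)) :=
        Finset.sum_congr rfl fun k _ => hu k
      rw [Finset.sum_add_distrib, ← hz, Finset.sum_const, Finset.card_univ, Fintype.card_fin,
        ← Nat.cast_smul_eq_nsmul F] at this
      rw [← sub_eq_iff_eq_add'.2 this]
      nth_rw 2 [← one_smul F (h 8 x)]
      rw [← sub_smul]
      norm_num
    refine hI 8 x ?_
    have h8 : h 8 x = (3 : F)⁻¹ • ∑ k, h (q k) (u k) := by
      rw [hsum, smul_smul, inv_mul_cancel₀ h3, one_smul]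
    rw [h8]
    refine Submodule.smul_mem _ _ (Submodule.sum_mem _ fun k _ => mem_messageSpan h ?_ _)
    revert k
    decide

/-- In characteristic three `I₃` needs broadcasts longer than eight messages. With `m k` the
encodings of the pairs of messages `(15, 16), (13, 14), (11, 12), (9, 10)` and `n` that of the pair
`(17, 18)`, the coordinates of `exists_block_coordinates` give `∑ k, m k (u k) = 3 • n x = 0`, and
so the first component of `u 3` vanishes, because user `9` can tell message `9` from the messages
`10, …, 16`. This places `n x` in the range of `P 3` for a space of vectors `x` of about half
the dimension, which is incompatible with the requirements of the users `33` and `34`. -/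
theorem I₃_bound {h : Fin 58 → V →ₗ[F] W} (hI : IsLinearSolution I₃ h) (h3 : (3 : F) = 0) :
    89 * finrank F V ≤ 11 * finrank F W := by
  have h8 : Fintype.card (Fin 8) * finrank F V ≤ finrank F W :=
    hI.card_mul_finrank_le I₃_clique
  rw [Fintype.card_fin] at h8
  obtain ⟨D, hD⟩ := Nat.exists_eq_add_of_le h8
  have hVV : finrank F (V × V) = 2 * finrank F V := by
    rw [Module.finrank_prod]; ring
  let p : Fin 4 → Fin 58 := ![0, 2, 4, 6]
  let p' : Fin 4 → Fin 58 := ![1, 3, 5, 7]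
  let q : Fin 4 → Fin 58 := ![14, 12, 10, 8]
  let q' : Fin 4 → Fin 58 := ![15, 13, 11, 9]
  -- The pairs of users `(25, 26), (43, 44), (37, 38), (31, 32)` and `(57, 58), …, (51, 52)`.
  let a : Fin 4 → Fin 58 := ![24, 42, 36, 30]
  let a' : Fin 4 → Fin 58 := ![25, 43, 37, 31]
  let c : Fin 4 → Fin 58 := ![56, 54, 52, 50]
  let c' : Fin 4 → Fin 58 := ![57, 55, 53, 51]
  let A : Fin 4 → Finset (Fin 58) := fun k => {p k, p' k}
  set P : Fin 4 → V × V →ₗ[F] W := fun k => (h (p k)).coprod (h (p' k)) with hPdef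
  set m : Fin 4 → V × V →ₗ[F] W := fun k => (h (q k)).coprod (h (q' k)) with hmdef
  set n : V × V →ₗ[F] W := (h 16).coprod (h 17)
  have hP : ∀ k, LinearMap.range (P k) = messageSpan h (A k) :=
    fun k => range_coprod_eq_messageSpan h _ _
  have hPsup : 4 * finrank F (V × V) ≤ finrank F ↥(⨆ k, LinearMap.range (P k)) := by
    rw [iSup_range_eq_messageSpan hP]
    have := hI.finrank_messageSpan_image I₃_clique Finset.univ
    rw [Finset.card_univ, Fintype.card_fin, show Finset.univ.image _ = Finset.univ.biUnion A from
      by decide +kernel] at this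
    omega
  refine Exists.elim (exists_block_coordinates (D := D) (P := P) (m := m) (n := n) hPsup
    ?_ ?_ ?_) fun X ⟨hX, hXz⟩ => ?_
  · intro k
    rw [iSup_range_ne_eq_messageSpan hP, range_coprod_eq_messageSpan, ← messageSpan_union]
    have := hI.finrank_add_add_le (i := p k) (j := p' k)
      (A := {q k, q' k} ∪ (Finset.univ.erase k).biUnion A)
      (by revert k; decide +kernel) (by revert k; decide +kernel)
    omega
  · intro k
    rw [hP, range_coprod_eq_messageSpan, ← messageSpan_union]
    have h₁ : A k ∪ {q k, q' k} = insert (p' k) (insert (p k) (insert (q' k) {q k})) := by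
      revert k; decide +kernel
    rw [h₁, hI.finrank_insert, hI.finrank_insert, hI.finrank_insert, hI.finrank_singleton]
    · omega
    all_goals revert k; decide +kernel
  · intro k
    rw [hP, range_coprod_eq_messageSpan, range_coprod_eq_messageSpan, ← messageSpan_union,
      ← messageSpan_union]
    let S : Fin 4 → Finset (Fin 58) := fun k => {16, 17} ∪ (A k ∪ {q k, q' k})
    have hS : ∀ k, S k ⊆ I₃.B (a k) ∧ insert (a k) (S k) ⊆ I₃.B (a' k) ∧
        insert (a' k) (insert (a k) (S k)) ⊆ I₃.B (c k) ∧
        insert (c k) (insert (a' k) (insert (a k) (S k))) ⊆ I₃.B (c' k) := by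
      decide +kernel
    have h₁ := hI.finrank_insert (hS k).1
    have h₂ := hI.finrank_insert (hS k).2.1
    have h₃ := hI.finrank_add_add_le (hS k).2.2.1 (hS k).2.2.2
    change finrank F (messageSpan h (S k)) ≤ _
    omega
  · -- The vectors `x` of `X` for which `n x` lies in the range of `P 3`.
    have hX' := finrank_add_finrank_le_inf_comap n (X := X) (S := LinearMap.range (P 3))
      (T := LinearMap.range (P 3) ⊔ LinearMap.range (h 9)) le_sup_left <| by
        rintro _ ⟨x, hx, rfl⟩
        obtain ⟨z, u, hz, hu⟩ := hXz x hx
        have hsum : ∑ k, m k (u k) = 0 := by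
          have : ∑ k : Fin 4, n x = ∑ k, (P k (z k) + m k (u k)) :=
            Finset.sum_congr rfl fun k _ => hu k
          rw [Finset.sum_add_distrib, ← hz, Finset.sum_const, Finset.card_univ, Fintype.card_fin,
            ← Nat.cast_smul_eq_nsmul F] at this
          rw [← sub_eq_iff_eq_add'.2 this]
          nth_rw 2 [← one_smul F (n x)]
          rw [← sub_smul, show ((4 : ℕ) : F) - 1 = 3 by norm_num, h3, zero_smul]
        have hu3 : (u 3).1 = 0 := by
          apply hI 8
          have : h 8 (u 3).1 = -(h 9 (u 3).2 + (h 10 (u 2).1 + h 11 (u 2).2) +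
              (h 12 (u 1).1 + h 13 (u 1).2) + (h 14 (u 0).1 + h 15 (u 0).2)) := by
            rw [eq_neg_iff_add_eq_zero, ← hsum, Fin.sum_univ_four]
            simp only [hmdef, LinearMap.coprod_apply]
            simp only [q, q', Matrix.cons_val]
            abel
          rw [this]
          refine Submodule.neg_mem _ (Submodule.add_mem _ (Submodule.add_mem _ (Submodule.add_mem _
            ?_ (Submodule.add_mem _ ?_ ?_)) (Submodule.add_mem _ ?_ ?_))
            (Submodule.add_mem _ ?_ ?_))
          all_goals exact mem_messageSpan h (by decide) _
        rw [hu 3]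
        refine Submodule.add_mem_sup ⟨_, rfl⟩ ⟨(u 3).2, ?_⟩
        simp [hmdef, hu3, q']
    have hT := Submodule.finrank_add_le_finrank_add_finrank (LinearMap.range (P 3))
      (LinearMap.range (h 9))
    have h9 := (h 9).finrank_range_le
    -- The encodings of the pair `(33, 34)` nearly fill the range of `P 3`.
    set g : V × V →ₗ[F] W := (h 32).coprod (h 33) with hgdef
    set T : Fin 4 → Submodule F W := fun k => ⨆ j, ⨆ (_ : j ≠ k), LinearMap.range (P j)
    have hg : ∀ v, g v ∈ messageSpan h {10, 11} → v = 0 := by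
      intro v hv
      have hv' : g v = h 32 v.1 + h 33 v.2 := LinearMap.coprod_apply ..
      refine Prod.ext (hI 32 _ ?_) (hI 33 _ ?_)
      · rw [eq_sub_of_add_eq hv'.symm]
        exact Submodule.sub_mem _ (messageSpan_mono h (by decide) hv)
          (mem_messageSpan h (by decide) _)
      · rw [eq_sub_of_add_eq' hv'.symm]
        exact Submodule.sub_mem _ (messageSpan_mono h (by decide) hv)
          (mem_messageSpan h (by decide) _)
    have hginj : Function.Injective g := by
      rw [injective_iff_map_eq_zero]
      exact fun v hv => hg v (hv ▸ Submodule.zero_mem _)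
    have hTg : ∀ k ≠ 3, finrank F (V × V) ≤ finrank F ((T k).comap g) + D := by
      intro k hk
      have h₁ := finrank_add_finrank_le_comap g (T k)
      have h₂ : 3 * finrank F (V × V) ≤ finrank F (T k) := three_mul_finrank_le hPsup k
      have h₃ : finrank F ↥(LinearMap.range g ⊔ T k) + 2 * finrank F V ≤ finrank F W := by
        rw [hgdef, range_coprod_eq_messageSpan,
          show T k = _ from iSup_range_ne_eq_messageSpan hP k, ← messageSpan_union, add_comm]
        clear h₁ h₂
        exact hI.finrank_add_add_le (i := p k) (j := p' k) (by revert k; decide +kernel)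
          (by revert k; decide +kernel)
      omega
    have hTP : T 0 ⊓ T 1 ⊓ T 2 ≤ LinearMap.range (P 3) := by
      rintro w ⟨⟨h0, h1⟩, h2⟩
      obtain ⟨y, hy, rfl⟩ := mem_iSup_range_ne h0
      obtain ⟨y', hy', h1⟩ := mem_iSup_range_ne h1
      obtain ⟨y'', hy'', h2⟩ := mem_iSup_range_ne h2
      have e₁ : y - y' = 0 := eq_zero_of_sum_eq_zero hPsup (by simp [h1])
      have e₂ : y - y'' = 0 := eq_zero_of_sum_eq_zero hPsup (by simp [h2])
      rw [sub_eq_zero] at e₁ e₂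
      rw [← e₁] at hy'
      rw [← e₂] at hy''
      exact ⟨y 3, by simp [Fin.sum_univ_four, hy, hy', hy'']⟩
    set K := (T 0).comap g ⊓ (T 1).comap g ⊓ (T 2).comap g
    have hK : finrank F (V × V) ≤ finrank F (K.map g) + 3 * D := by
      rw [← (Submodule.equivMapOfInjective g hginj K).finrank_eq]
      have h₁ := finrank_add_finrank_le_inf ((T 0).comap g) ((T 1).comap g)
      have h₂ : _ ≤ finrank F K + _ := finrank_add_finrank_le_inf ((T 0).comap g ⊓ (T 1).comap g) ((T 2).comap g)
      have := hTg 0 (by decide)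
      have := hTg 1 (by decide)
      have := hTg 2 (by decide)
      omega
    have hX'' := finrank_add_finrank_le_inf_comap n (X := X ⊓ (LinearMap.range (P 3)).comap n)
      (S := K.map g) (T := LinearMap.range (P 3))
      (by rintro _ ⟨v, hv, rfl⟩; exact hTP hv)
      (by rintro _ ⟨v, hv, rfl⟩; exact hv.2)
    have hPfin : finrank F (LinearMap.range (P 3)) ≤ finrank F (V × V) := (P 3).finrank_range_le
    suffices hbot : X ⊓ (LinearMap.range (P 3)).comap n ⊓ (K.map g).comap n = ⊥ by
      rw [hbot, finrank_bot] at hX''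
      omega
    rw [eq_bot_iff]
    rintro x ⟨⟨hx, y, hy⟩, v, -, hv⟩
    obtain ⟨z, u, hz, hu⟩ := hXz x hx
    have hzy : z - Pi.single 3 y = 0 := by
      apply eq_zero_of_sum_eq_zero hPsup
      simp only [Pi.sub_apply, map_sub, Finset.sum_sub_distrib, ← hz]
      rw [Finset.sum_eq_single 3 (by simp +contextual) (by simp), Pi.single_eq_same, hy, sub_self]
    have hz2 : z 2 = 0 := by
      rw [sub_eq_zero.1 hzy]
      rfl
    have hv0 : v = 0 := by
      apply hg
      rw [hv, hu 2, hz2, map_zero, zero_add, ← range_coprod_eq_messageSpan]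
      exact ⟨u 2, rfl⟩
    rw [hv0, map_zero] at hv
    have hx' : h 16 x.1 + h 17 x.2 = 0 := by
      rw [hv]
      exact (LinearMap.coprod_apply ..).symm
    refine Prod.ext (hI 16 _ ?_) (hI 17 _ ?_)
    · rw [eq_neg_of_add_eq_zero_left hx']
      exact Submodule.neg_mem _ (mem_messageSpan h (by decide) _)
    · rw [eq_neg_of_add_eq_zero_right hx']
      exact Submodule.neg_mem _ (mem_messageSpan h (by decide) _)

end IsLinearSolution

end LinearBounds

/-! ### Acyclic instances -/

section Acyclic

variable {ι : Type} [Fintype ι] [DecidableEq ι]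

open Fin.CommRing in
/-- A closed walk of minimal length along the relation "user `i` knows message `j`" has no chords,
hence is a minimal cyclic set. So an acyclic instance has no closed walk. -/
theorem Instance.IsAcyclic.not_exists_closed_walk {I : Instance ι} (hI : I.IsAcyclic) :
    ¬ ∃ (k : ℕ) (c : Fin (k + 2) → ι), ∀ j, c (j + 1) ≠ c j ∧ c (j + 1) ∉ I.B (c j) := by
  classical
  intro hex
  obtain ⟨k, ⟨c, hc⟩, hmin⟩ : ∃ k, (∃ c : Fin (k + 2) → ι,
      ∀ j, c (j + 1) ≠ c j ∧ c (j + 1) ∉ I.B (c j)) ∧ ∀ l < k, ¬ ∃ c : Fin (l + 2) → ι,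
      ∀ j, c (j + 1) ≠ c j ∧ c (j + 1) ∉ I.B (c j) :=
    ⟨Nat.find hex, Nat.find_spec hex, fun _ => Nat.find_min hex⟩
  have chord : ∀ a b, c b ≠ c a → c b ∉ I.B (c a) → b = a + 1 := by
    intro a b hne hB
    by_contra hba
    -- The chord from `a` to `b` closes the part of the walk from `b` to `a`.
    set d := (a - b).val with hd
    have hda : b + (d : Fin (k + 2)) = a := by
      rw [hd, Fin.cast_val_eq_self]; abel
    have hd0 : d ≠ 0 := by
      intro h
      rw [h, Nat.cast_zero, add_zero] at hda
      exact hne (by rw [hda])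
    have hdk : d ≠ k + 1 := by
      intro h
      apply hba
      rw [← hda, h, add_assoc]
      have : ((k + 1 : ℕ) : Fin (k + 2)) + 1 = 0 := by
        rw [← Nat.cast_succ]
        exact Fin.natCast_self _
      rw [this, add_zero]
    have hlt : d < k + 2 := (a - b).isLt
    refine hmin (d - 1) (by omega)
      ⟨fun i => c (b + (i.val : Fin (k + 2))), fun i => ?_⟩
    beta_reduce
    by_cases hi : i.val + 1 < d - 1 + 2
    · have hi' : (i + 1).val = i.val + 1 := Fin.val_add_one_of_lt' hi
      rw [hi', Nat.cast_succ, ← add_assoc]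
      exact hc _
    · have hi' : i = Fin.last _ := Fin.ext (by simp; omega)
      have hi'' : i.val = d := by rw [hi', Fin.val_last]; omega
      have h0 : i + 1 = 0 := by rw [hi', Fin.last_add_one]
      rw [h0, hi'', hda, Fin.val_zero, Nat.cast_zero, add_zero]
      exact ⟨hne, hB⟩
  have hinj : Function.Injective c := by
    intro a b hab
    have h := hc (a - 1)
    rw [sub_add_cancel, hab] at h
    rw [chord (a - 1) b h.1 h.2, sub_add_cancel]
  refine hI (Finset.univ.image c) (Finset.subset_univ _) ⟨k, c, hinj, rfl, fun j => ?_⟩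
  ext x
  simp only [Finset.mem_inter, Finset.mem_image, Finset.mem_univ, true_and, Finset.mem_sdiff,
    Finset.mem_insert, Finset.mem_singleton, not_or]
  constructor
  · rintro ⟨hx, hx'⟩
    exact ⟨hx', fun h => I.not_mem_B _ (h ▸ hx), fun h => (hc j).2 (h ▸ hx)⟩
  · rintro ⟨⟨l, rfl⟩, h₁, h₂⟩
    refine ⟨?_, l, rfl⟩
    by_contra hB
    exact h₂ (by rw [chord j l h₁ hB])

theorem Instance.IsAcyclic.exists_erase_subset {I : Instance ι} (hI : I.IsAcyclic)
    {A : Finset ι} (hA : A.Nonempty) : ∃ i ∈ A, A.erase i ⊆ I.B i := by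
  by_contra! hno
  have hnext : ∀ i : A, ∃ j : A, j.1 ≠ i.1 ∧ j.1 ∉ I.B i.1 := by
    rintro ⟨i, hi⟩
    obtain ⟨j, hj, hB⟩ := Finset.not_subset.1 (hno i hi)
    exact ⟨⟨j, Finset.mem_of_mem_erase hj⟩, Finset.ne_of_mem_erase hj, hB⟩
  choose f hf using hnext
  obtain ⟨a, ha⟩ := hA
  obtain ⟨p, q, hpq, heq⟩ : ∃ p q, p < q ∧ f^[p] ⟨a, ha⟩ = f^[q] ⟨a, ha⟩ := by
    obtain ⟨p, q, hne, heq⟩ := Finite.exists_ne_map_eq_of_infinite fun n => f^[n] ⟨a, ha⟩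
    rcases hne.lt_or_gt with h | h
    exacts [⟨p, q, h, heq⟩, ⟨q, p, h, heq.symm⟩]
  have hstep : ∀ n, (f^[n + 1] ⟨a, ha⟩).1 ≠ (f^[n] ⟨a, ha⟩).1 ∧
      (f^[n + 1] ⟨a, ha⟩).1 ∉ I.B (f^[n] ⟨a, ha⟩).1 := by
    intro n
    rw [Function.iterate_succ_apply']
    exact hf _
  have hpq' : q ≠ p + 1 := by
    rintro rfl
    exact (hstep p).1 (by rw [heq])
  refine hI.not_exists_closed_walk ⟨q - p - 2, fun i => (f^[p + i.val] ⟨a, ha⟩).1, fun i => ?_⟩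
  beta_reduce
  by_cases hi : i.val + 1 < q - p - 2 + 2
  · rw [show (i + 1).val = i.val + 1 from Fin.val_add_one_of_lt' hi]
    exact hstep _
  · have hi' : i = Fin.last _ := Fin.ext (by simp; omega)
    have h0 : i + 1 = 0 := by rw [hi', Fin.last_add_one]
    have h := hstep (p + i.val)
    rw [show p + i.val + 1 = q by rw [hi', Fin.val_last]; omega, ← heq] at h
    rw [h0]
    exact h

open Module in
theorem IsLinearSolution.card_mul_finrank_le_of_isAcyclic {F V W : Type*} [Field F]
    [AddCommGroup V] [Module F V] [AddCommGroup W] [Module F W] [FiniteDimensional F W]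
    {I : Instance ι} {h : ι → V →ₗ[F] W} (hI : IsLinearSolution I h) (hac : I.IsAcyclic) :
    Fintype.card ι * finrank F V ≤ finrank F W := by
  have key : ∀ A : Finset ι, finrank F (messageSpan h A) = A.card * finrank F V := by
    intro A
    induction A using Finset.strongInduction with
    | H A ih =>
      rcases A.eq_empty_or_nonempty with rfl | hA
      · rw [messageSpan_empty, finrank_bot, Finset.card_empty, zero_mul]
      · obtain ⟨i, hi, hB⟩ := hac.exists_erase_subset hA
        have h₁ := hI.finrank_insert hB
        rw [Finset.insert_erase hi, ih _ (Finset.erase_ssubset hi)] at h₁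
        rw [h₁, ← Finset.card_erase_add_one hi]
        ring
  rw [← Finset.card_univ, ← key]
  exact Submodule.finrank_le _

/-- If all messages interfere with each other, no user knows anything and there are no cycles. -/
theorem exists_isAcyclic (n : ℕ) : ∃ I : Instance (Fin n), I.IsAcyclic := by
  refine ⟨⟨fun i => {i}ᶜ, by simp⟩, ?_⟩
  rintro M - ⟨k, c, hc, rfl, h⟩
  have h0 := congrArg (c (0 + 1) ∈ ·) (h 0)
  have hne : c (0 + 1) ≠ c 0 := by
    rw [hc.ne_iff, zero_add]
    exact Fin.zero_ne_one.symm
  simp at h0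
  simp_all

end Acyclic

/-! ### Index codes and broadcast rates -/

section Codes

variable {ι κ X Y : Type} [Fintype ι] [Fintype κ] [DecidableEq ι]

theorem Instance.mem_sideInfo {I : Instance ι} {i l : ι} :
    l ∈ I.sideInfo i ↔ l ≠ i ∧ l ∉ I.B i := by
  simp [Instance.sideInfo, not_or]

/-- User `i` can decode if message `i` is determined by the broadcast and the side information. -/
theorem IndexCode.exists_encode_eq [Nonempty X] {I : Instance ι} {t r : ℕ}
    (f : (ι → Fin t → X) → Fin r → X)
    (hf : ∀ i x y, f x = f y → (∀ l, l ≠ i → l ∉ I.B i → x l = y l) → x i = y i) :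
    ∃ C : IndexCode I X t r, C.encode = f := by
  classical
  have hdec : ∀ i, ∃ d : (Fin r → X) → ({l // l ∈ I.sideInfo i} → Fin t → X) → Fin t → X,
      ∀ x, d (f x) (fun l => x l.1) = x i := by
    intro i
    refine ⟨fun b s => if h : ∃ x, f x = b ∧ (fun l => x l.1) = s then h.choose i
      else Classical.arbitrary _, fun x => ?_⟩
    have h : ∃ y, f y = f x ∧ (fun l : {l // l ∈ I.sideInfo i} => y l.1) = fun l => x l.1 :=
      ⟨x, rfl, rfl⟩
    beta_reduce
    rw [dif_pos h]
    refine hf i _ _ h.choose_spec.1 fun l h₁ h₂ => ?_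
    exact congrFun h.choose_spec.2 ⟨l, Instance.mem_sideInfo.2 ⟨h₁, h₂⟩⟩
  choose d hd using hdec
  exact ⟨⟨f, d, fun x i => hd i x⟩, rfl⟩

theorem IndexCode.apply_eq {I : Instance ι} {t r : ℕ} (C : IndexCode I X t r) {i : ι}
    {x y : ι → Fin t → X} (h : C.encode x = C.encode y)
    (hxy : ∀ l, l ≠ i → l ∉ I.B i → x l = y l) : x i = y i := by
  rw [← C.correct x i, ← C.correct y i, h]
  congr 1
  funext l
  have := Instance.mem_sideInfo.1 l.2
  exact hxy _ this.1 this.2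

/-- Codes for the two parts of a no-way connection are used side by side. -/
theorem IndexCode.exists_noWay [DecidableEq κ] [Nonempty X] {I : Instance ι} {J : Instance κ} {t r s : ℕ}
    (C : IndexCode I X t r) (D : IndexCode J X t s) :
    ∃ E : IndexCode (I.noWay J) X t (r + s), ∀ x,
      E.encode x = Fin.append (C.encode fun i => x (.inl i)) (D.encode fun k => x (.inr k)) := by
  obtain ⟨E, hE⟩ := IndexCode.exists_encode_eq (I := I.noWay J) (fun x =>
    Fin.append (C.encode fun i => x (.inl i)) (D.encode fun k => x (.inr k))) <| by
      intro i x y hxy hs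
      have h₁ : (C.encode fun i => x (.inl i)) = C.encode fun i => y (.inl i) := by
        funext j
        simpa using congrFun hxy (Fin.castAdd s j)
      have h₂ : (D.encode fun k => x (.inr k)) = D.encode fun k => y (.inr k) := by
        funext j
        simpa using congrFun hxy (Fin.natAdd r j)
      rcases i with i | k
      · exact C.apply_eq h₁ fun l hl hB =>
          hs (.inl l) (by simpa using hl) (by simpa [Instance.noWay] using hB)
      · exact D.apply_eq h₂ fun l hl hB =>
          hs (.inr l) (by simpa using hl) (by simpa [Instance.noWay] using hB)
  exact ⟨E, fun x => by rw [hE]⟩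

/-- Codes for the two parts of a two-way connection are added: every user knows the contribution of
the other part. -/
theorem IndexCode.exists_twoWay [DecidableEq κ] [AddCommGroup X] {I : Instance ι} {J : Instance κ} {t r : ℕ}
    (C : IndexCode I X t r) (D : IndexCode J X t r) :
    ∃ E : IndexCode (I.twoWay J) X t r, ∀ x,
      E.encode x = C.encode (fun i => x (.inl i)) + D.encode fun k => x (.inr k) := by
  obtain ⟨E, hE⟩ := IndexCode.exists_encode_eq (I := I.twoWay J) (fun x =>
    C.encode (fun i => x (.inl i)) + D.encode fun k => x (.inr k)) <| by
      intro i x y hxy hs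
      rcases i with i | k
      · have h : (fun k => x (.inr k)) = fun k => y (.inr k) :=
          funext fun k => hs _ (by simp) (by simp [Instance.twoWay])
        rw [h, add_left_inj] at hxy
        exact C.apply_eq hxy fun l hl hB =>
          hs (.inl l) (by simpa using hl) (by simpa [Instance.twoWay] using hB)
      · have h : (fun i => x (.inl i)) = fun i => y (.inl i) :=
          funext fun i => hs _ (by simp) (by simp [Instance.twoWay])
        rw [h, add_right_inj] at hxy
        exact D.apply_eq hxy fun l hl hB =>
          hs (.inr l) (by simpa using hl) (by simpa [Instance.twoWay] using hB)
  exact ⟨E, fun x => by rw [hE]⟩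

theorem IndexCode.nonempty_uncoded [Nonempty X] {n : ℕ} (I : Instance (Fin n)) :
    ∃ C : IndexCode I X 1 n, ∀ x, C.encode x = fun k => x k 0 := by
  obtain ⟨C, hC⟩ := IndexCode.exists_encode_eq (I := I) (t := 1) (X := X)
    (fun x k => x k 0) <| by
      intro i x y hxy _
      funext j
      rw [Subsingleton.elim j 0]
      exact congrFun hxy i
  exact ⟨C, fun x => by rw [hC]⟩

/-- A code over the alphabet `Y` carries over to the alphabet `X`: words over `X` are turned into
words over `Y`, symbol by symbol of the latter the given code is applied, and the resulting
broadcast is turned into a word over `X`. -/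
theorem IndexCode.nonempty_of_card_le [Finite X] [Nonempty X] [Finite Y] {I : Instance ι}
    {r s T R : ℕ} (C : IndexCode I Y 1 r) (hs : Nat.card X ^ T ≤ Nat.card Y ^ s)
    (hR : Nat.card Y ^ (r * s) ≤ Nat.card X ^ R) : Nonempty (IndexCode I X T R) := by
  have := Fintype.ofFinite X
  have := Fintype.ofFinite Y
  simp only [Nat.card_eq_fintype_card] at hs hR
  obtain ⟨e⟩ : Nonempty ((Fin T → X) ↪ (Fin s → Y)) :=
    Function.Embedding.nonempty_of_card_le (by simpa using hs)
  obtain ⟨g⟩ : Nonempty ((Fin s → Fin r → Y) ↪ (Fin R → X)) :=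
    Function.Embedding.nonempty_of_card_le (by simpa [← pow_mul] using hR)
  obtain ⟨D, -⟩ := IndexCode.exists_encode_eq (I := I)
    (fun x => g fun k => C.encode fun i _ => e (x i) k) <| by
      intro i x y hxy hs
      have h := g.injective hxy
      apply e.injective
      funext k
      have h₁ := C.apply_eq (i := i) (congrFun h k) fun l hl hB => by rw [hs l hl hB]
      exact congrFun h₁ 0
  exact ⟨D⟩

/-- Words of pairwise interfering messages are determined by the broadcast. -/
theorem IndexCode.card_mul_le [Finite X] [Nontrivial X] {I : Instance ι}
    {t r : ℕ} (C : IndexCode I X t r) {c : κ → ι} (hc : ∀ a b, a ≠ b → c b ∈ I.B (c a)) :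
    Fintype.card κ * t ≤ r := by
  classical
  have := Fintype.ofFinite X
  have hinj : Function.Injective c := by
    intro a b hab
    by_contra hne
    exact I.not_mem_B _ (hab ▸ hc a b hne)
  obtain ⟨x₀⟩ : Nonempty X := inferInstance
  have hf : Function.Injective fun x : κ → Fin t → X =>
      C.encode (Function.extend c x fun _ _ => x₀) := by
    intro x y hxy
    funext a
    have h := C.apply_eq (i := c a) hxy fun l hl hB => by
      by_cases h : ∃ b, c b = l
      · obtain ⟨b, rfl⟩ := h
        exact absurd (hc a b (by rintro rfl; exact hl rfl)) hB
      · rw [Function.extend_apply' _ _ _ h, Function.extend_apply' _ _ _ h]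
    rwa [hinj.extend_apply, hinj.extend_apply] at h
  have hcard := Fintype.card_le_of_injective _ hf
  simp only [Fintype.card_fun, Fintype.card_fin, ← pow_mul] at hcard
  rw [mul_comm]
  exact (Nat.pow_le_pow_iff_right Fintype.one_lt_card).1 hcard

/-- A code over any alphabet yields codes of nearly the same rate over every other alphabet, as words
over one alphabet can be encoded by words over another one with bounded loss. -/
theorem IndexCode.exists_forall_nonempty [Finite X] [Nontrivial X] [Finite Y] [Nontrivial Y]
    {I : Instance ι} {r : ℕ} (C : IndexCode I Y 1 r) :
    ∃ c, ∀ T, 0 < T → Nonempty (IndexCode I X T (r * T + c)) := by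
  have hX : 1 < Nat.card X := Finite.one_lt_card
  have hY : 1 < Nat.card Y := Finite.one_lt_card
  obtain ⟨c, hc⟩ : ∃ c, Nat.card Y ^ r ≤ Nat.card X ^ c := ⟨_, (Nat.lt_pow_self hX).le⟩
  refine ⟨c, fun T hT => ?_⟩
  -- Taking `s` minimal gives `|Y| ^ (s - 1) ≤ |X| ^ T`.
  set s := Nat.clog (Nat.card Y) (Nat.card X ^ T)
  refine C.nonempty_of_card_le (s := s) (Nat.le_pow_clog hY _) ?_
  have hs0 : 0 < s := Nat.clog_pos hY (Nat.one_lt_pow hT.ne' hX)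
  have h₁ : Nat.card Y ^ (s - 1) ≤ Nat.card X ^ T :=
    (Nat.pow_pred_clog_lt_self hY (Nat.one_lt_pow hT.ne' hX)).le
  calc Nat.card Y ^ (r * s) = (Nat.card Y ^ (s - 1)) ^ r * Nat.card Y ^ r := by
        rw [← pow_mul, ← pow_add]
        congr 1
        obtain ⟨u, hu⟩ := Nat.exists_eq_add_of_lt hs0
        rw [hu]
        simp
        ring
    _ ≤ (Nat.card X ^ T) ^ r * Nat.card X ^ c := by gcongr
    _ = Nat.card X ^ (r * T + c) := by rw [← pow_mul, ← pow_add, mul_comm T]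

/-- If there is a code of rate `r` over some alphabet, and `r` pairwise interfering messages, then
the broadcast rate is `r` over every alphabet. -/
theorem broadcastRate_eq [Finite X] [Nontrivial X] [Finite Y] [Nontrivial Y] {I : Instance ι}
    {r : ℕ} (C : IndexCode I Y 1 r) {c : κ → ι} (hc : ∀ a b, a ≠ b → c b ∈ I.B (c a))
    (hr : Fintype.card κ = r) : broadcastRate X I = r := by
  obtain ⟨e, hcode⟩ := C.exists_forall_nonempty (X := X)
  apply le_antisymm
  · have hbdd : BddBelow {ρ : ℝ | ∃ t r : ℕ, 0 < t ∧ Nonempty (IndexCode I X t r) ∧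
        ρ = (r : ℝ) / (t : ℝ)} := by
      refine ⟨0, ?_⟩
      rintro _ ⟨t, r, -, -, rfl⟩
      positivity
    have hle : ∀ T : ℕ, 0 < T → broadcastRate X I ≤ r + (e : ℝ) / T := by
      intro T hT
      refine csInf_le hbdd ⟨T, _, hT, hcode T hT, ?_⟩
      have : (T : ℝ) ≠ 0 := by exact_mod_cast hT.ne'
      push_cast
      field_simp
    have hlim : Filter.Tendsto (fun T : ℕ => (r : ℝ) + (e : ℝ) / T) Filter.atTop (nhds r) := by
      simpa using (tendsto_const_div_atTop_nhds_zero_nat (e : ℝ)).const_add (r : ℝ)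
    exact ge_of_tendsto hlim (Filter.eventually_atTop.2 ⟨1, fun T hT => hle T hT⟩)
  · refine le_csInf ⟨_, 1, _, Nat.one_pos, hcode 1 Nat.one_pos, rfl⟩ ?_
    rintro _ ⟨t, r, ht, ⟨C⟩, rfl⟩
    rw [le_div_iff₀ (by exact_mod_cast ht), ← hr]
    exact_mod_cast C.card_mul_le hc

theorem LinearIndexCode.nonempty_uncoded (F : Type) [Field F] (I : Instance ι) :
    Nonempty (LinearIndexCode I F 1 (Fintype.card ι)) := by
  refine ⟨fun i => Matrix.of fun k _ => if Fintype.equivFin ι i = k then 1 else 0,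
    fun i => LinearMap.pi fun _ => LinearMap.proj (Fintype.equivFin ι i) ∘ₗ LinearMap.fst F _ _,
    fun x i => ?_⟩
  funext j
  rw [Subsingleton.elim j 0]
  simp [Matrix.mulVec, dotProduct, Finset.sum_apply]

theorem le_linearBroadcastRateOver (F : Type) [Field F] {I : Instance ι} {ρ : ℝ}
    (h : ∀ t r : ℕ, LinearIndexCode I F t r → ρ * t ≤ r) :
    ρ ≤ linearBroadcastRateOver F I := by
  obtain ⟨C⟩ := LinearIndexCode.nonempty_uncoded F I
  refine le_csInf ⟨_, 1, _, Nat.one_pos, ⟨C⟩, rfl⟩ ?_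
  rintro _ ⟨t, r, ht, ⟨C⟩, rfl⟩
  rw [le_div_iff₀ (by exact_mod_cast ht)]
  exact h t r C

theorem le_linearBroadcastRate {I : Instance ι} {ρ : ℝ}
    (h : ∀ (F : Type) [Field F], ρ ≤ linearBroadcastRateOver F I) :
    ρ ≤ linearBroadcastRate I := by
  refine le_csInf ⟨_, ZMod 2, inferInstance, inferInstance, rfl⟩ ?_
  rintro _ ⟨F, _, _, rfl⟩
  exact h F

end Codes

/-! ### Explicit codes over `GF(3)` -/

section Constructions

/-- The encoding vectors over `GF(3)` of a linear code of rate four for `I₁`; the element `i` of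
`Fin 29` stands for message `i + 1`. The messages `1, …, 4` and each of the quadruples
`10, …, 13` to `22, …, 25` are encoded by the unit vectors, the messages `8, 7, 6, 5` by the sums of
all unit vectors but one, and message `9` by the sum of all unit vectors. -/
def encodingVector₁ (i : Fin 29) : Fin 4 → ZMod 3 :=
  if i.val < 4 then Pi.single (Fin.ofNat 4 i.val) 1
  else if i.val < 8 then 1 - Pi.single (Fin.ofNat 4 (7 - i.val)) 1
  else if i.val = 8 then 1
  else if i.val < 25 then Pi.single (Fin.ofNat 4 (i.val - 9)) 1
  else Pi.single (![0, 0, 2, 1] (Fin.ofNat 4 (i.val - 25))) 1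

/-- For each user of `I₁` a linear form which is one on its own encoding vector and zero on those
of the interfering messages. -/
def decodingForm₁ : Fin 29 → Fin 4 → ZMod 3 :=
  ![![1, 0, 0, 0], ![0, 1, 0, 0], ![0, 0, 1, 0], ![0, 0, 0, 1],
    ![1, 1, -1, 0], ![1, -1, 0, 1], ![-1, 0, 1, 1], ![0, 1, 1, -1], ![1, 1, 1, 1],
    ![1, 0, -1, 0], ![-1, 1, 0, 0], ![0, -1, 1, 0], ![0, -1, 0, 1],
    ![1, 0, 0, -1], ![-1, 1, 0, 0], ![-1, 0, 1, 0], ![0, -1, 0, 1],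
    ![1, 0, 0, -1], ![-1, 1, 0, 0], ![-1, 0, 1, 0], ![0, 0, -1, 1],
    ![1, 0, -1, 0], ![0, 1, 0, -1], ![0, -1, 1, 0], ![0, 0, -1, 1],
    ![1, -1, 0, 0], ![1, 0, 0, -1], ![0, 0, 1, -1], ![0, 1, -1, 0]]

theorem decodingForm₁_apply : ∀ i, decodingForm₁ i ⬝ᵥ encodingVector₁ i = 1 ∧
    ∀ j ∈ I₁.B i, decodingForm₁ i ⬝ᵥ encodingVector₁ j = 0 := by
  decide +kernel

theorem exists_code₁ : Nonempty (IndexCode I₁ (ZMod 3) 1 4) := by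
  obtain ⟨C, -⟩ := IndexCode.exists_encode_eq (I := I₁) (X := ZMod 3) (t := 1)
    (fun x => ∑ j, x j 0 • encodingVector₁ j) <| by
      intro i x y hxy hs
      have h : decodingForm₁ i ⬝ᵥ ∑ j, (x j 0 - y j 0) • encodingVector₁ j = 0 := by
        simp only [sub_smul, Finset.sum_sub_distrib, hxy, sub_self, dotProduct_zero]
      rw [dotProduct_sum, Finset.sum_eq_single i] at h
      · rw [dotProduct_smul, (decodingForm₁_apply i).1, smul_eq_mul, mul_one, sub_eq_zero] at h
        funext k
        rw [Subsingleton.elim k 0]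
        exact h
      · intro j _ hj
        by_cases hB : j ∈ I₁.B i
        · rw [dotProduct_smul, (decodingForm₁_apply i).2 j hB, smul_zero]
        · rw [hs j hj hB, sub_self, zero_smul, dotProduct_zero]
      · simp
  exact ⟨C⟩

/-- The coefficient of message `j` in the `k`-th sum modulo nine. Each of the pairs of messages
`(9, 10), …, (17, 18)` is read as a number of two ternary digits, the lower digit first, and the
`k`-th sum leaves out the pair `(15, 16)`, …, `(9, 10)`, respectively. -/
def carryCoeff (k : Fin 4) (j : Fin 58) : ZMod 9 :=
  if 8 ≤ j.val ∧ j.val < 18 ∧ k.val + (j.val - 8) / 2 ≠ 3 then 3 ^ (j.val % 2) else 0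

/-- The coefficient of message `j` in the `l`-th component, over `GF(3)`, of the `k`-th block of
the broadcast. -/
def plainCoeff (k : Fin 4) (l : Fin 2) (j : Fin 58) : ZMod 3 :=
  if j.val % 2 = l.val ∧
    (j.val < 8 ∧ j.val / 2 = k.val ∨ 18 ≤ j.val ∧ j.val < 50 ∧ (j.val - 18) / 2 % 4 = k.val ∨
      50 ≤ j.val ∧ ![0, 0, 2, 1] (Fin.ofNat 4 ((j.val - 50) / 2)) = k)
  then 1 else 0

/-- The ternary digits of an integer modulo nine, the lower one first. -/
def ternaryDigit (l : Fin 2) (z : ZMod 9) : ZMod 3 := ((z.val / 3 ^ l.val : ℕ) : ZMod 3)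

/-- The `k`-th sum modulo nine. -/
def carrySum (x : Fin 58 → ZMod 3) (k : Fin 4) : ZMod 9 :=
  ∑ j, carryCoeff k j * ((x j).val : ZMod 9)

/-- The `l`-th component of the `k`-th sum over `GF(3)`. -/
def plainSum (x : Fin 58 → ZMod 3) (k : Fin 4) (l : Fin 2) : ZMod 3 :=
  ∑ j, plainCoeff k l j * x j

/-- The broadcast of a nonlinear code for `I₃`: its `k`-th block of length two consists of the
ternary digits of a sum modulo nine, to which plain sums over `GF(3)` are added. -/
def encode₃ (x : Fin 58 → ZMod 3) (k : Fin 4) (l : Fin 2) : ZMod 3 :=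
  ternaryDigit l (carrySum x k) + plainSum x k l

theorem ternaryDigit_injective {z w : ZMod 9}
    (h : ∀ l, ternaryDigit l z = ternaryDigit l w) : z = w := by
  revert z w
  decide +kernel

theorem sum_mul_congr {ι R : Type*} [Fintype ι] [CommSemiring R] {c : ι → R} {f g : ι → R}
    (h : ∀ j, f j = g j ∨ c j = 0) : ∑ j, c j * f j = ∑ j, c j * g j :=
  Finset.sum_congr rfl fun j _ => by rcases h j with h | h <;> simp [h]

theorem apply_eq_of_sum_mul_eq {ι R : Type*} [Fintype ι] [CommRing R] {c : ι → R} {f g : ι → R}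
    {i : ι} (hsum : ∑ j, c j * f j = ∑ j, c j * g j) (hi : c i = 1)
    (h : ∀ j ≠ i, f j = g j ∨ c j = 0) : f i = g i := by
  classical
  have h₁ : ∑ j, c j * (f j - g j) = 0 := by
    simp only [mul_sub, Finset.sum_sub_distrib, hsum, sub_self]
  rw [Finset.sum_eq_single i, hi, one_mul, sub_eq_zero] at h₁
  · exact h₁
  · intro j _ hj
    rcases h j hj with h | h <;> simp [h]
  · simp

/-- The users `9, …, 18` decode from the carry sums: these linear combinations of the four sums
contain, of the messages unknown to the user, only its own pair, either as it stands or, for the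
users `9, 11, 13, 15`, with the coefficient three, which leaves its lower digit. -/
def carryForm : Fin 58 → Fin 4 → ZMod 9
  | 8 => ![1, 1, 1, -2]
  | 9 => ![1, 0, 0, -1]
  | 10 => ![1, 1, -2, 1]
  | 11 => ![0, 0, -1, 1]
  | 12 => ![1, -2, 1, 1]
  | 13 => ![0, -1, 1, 0]
  | 14 => ![-2, 1, 1, 1]
  | 15 => ![-1, 1, 0, 0]
  | _ => ![1, 0, 0, 0]

/-- The users of messages that enter as plain summands either know all messages in the carry sum of
their block or can take the unknown part of it from another block `b`, where they know all plain
summands. -/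
theorem plainCoeff_spec : ∀ i : Fin 58, (i.val < 8 ∨ 18 ≤ i.val) → ∃ a l, plainCoeff a l i = 1 ∧
    (∀ j ∈ I₃.B i, plainCoeff a l j = 0) ∧
    ((∀ j ∈ insert i (I₃.B i), carryCoeff a j = 0) ∨
      ∃ b, ∀ j ∈ insert i (I₃.B i), carryCoeff a j = carryCoeff b j ∧
        ∀ l, plainCoeff b l j = 0) := by
  decide +kernel

/-- For the users `9, …, 18`, `p` is the other message of the pair. -/
theorem carryForm_spec : ∀ i : Fin 58, 8 ≤ i.val → i.val < 18 →
    (∀ j ∈ insert i (I₃.B i), ∀ k l, plainCoeff k l j = 0) ∧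
    ∃ p : Fin 58, p ≠ i ∧
      (∀ j ∈ I₃.B i, j ≠ p → ∑ k, carryForm i k * carryCoeff k j = 0) ∧
      (∑ k, carryForm i k * carryCoeff k i, ∑ k, carryForm i k * carryCoeff k p) ∈
        ({(3, 0), (1, 3), (3, 1)} : Finset (ZMod 9 × ZMod 9)) := by
  decide +kernel

theorem eq_of_digits : ∀ v ∈ ({(3, 0), (1, 3), (3, 1)} : Finset (ZMod 9 × ZMod 9)),
    ∀ a b a' b' : ZMod 3, v.1 * ((a.val : ZMod 9) - a'.val) + v.2 * ((b.val : ZMod 9) - b'.val) = 0 →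
      a = a' := by
  decide +kernel

section Decoding

variable {x y : Fin 58 → ZMod 3}

theorem carrySum_eq_of_plainSum_eq (hxy : encode₃ x = encode₃ y) {b : Fin 4}
    (h : ∀ l, plainSum x b l = plainSum y b l) : carrySum x b = carrySum y b := by
  apply ternaryDigit_injective
  intro l
  have h₁ := congrFun (congrFun hxy b) l
  rwa [encode₃, encode₃, h l, add_left_inj] at h₁

/-- All users of `I₃` can decode from `encode₃`. -/
theorem apply_eq_of_encode₃_eq {i : Fin 58} (hxy : encode₃ x = encode₃ y)
    (hs : ∀ l, l ≠ i → l ∉ I₃.B i → x l = y l) : x i = y i := by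
  have hs' : ∀ l, x l = y l ∨ l ∈ insert i (I₃.B i) := by
    intro l
    by_cases hl : l ∈ insert i (I₃.B i)
    · exact .inr hl
    · rw [Finset.mem_insert, not_or] at hl
      exact .inl (hs l hl.1 hl.2)
  by_cases hi : i.val < 8 ∨ 18 ≤ i.val
  · obtain ⟨a, l, hi, hB, hc⟩ := plainCoeff_spec i hi
    have hc' : carrySum x a = carrySum y a := by
      rcases hc with hc | ⟨b, hb⟩
      · refine sum_mul_congr fun j => ?_
        exact (hs' j).imp (fun h => by rw [h]) (hc j)
      · have h₁ : carrySum x b = carrySum y b := carrySum_eq_of_plainSum_eq hxy fun l =>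
          sum_mul_congr fun j => (hs' j).imp_right fun h => (hb j h).2 l
        have h₂ : ∑ j, (carryCoeff a j - carryCoeff b j) * ((x j).val : ZMod 9) =
            ∑ j, (carryCoeff a j - carryCoeff b j) * ((y j).val : ZMod 9) :=
          sum_mul_congr fun j =>
            (hs' j).imp (fun h => by rw [h]) fun h => sub_eq_zero.2 (hb j h).1
        simp only [sub_mul, Finset.sum_sub_distrib] at h₂
        change carrySum x a - carrySum x b = carrySum y a - carrySum y b at h₂
        rwa [h₁, sub_left_inj] at h₂
    have h := congrFun (congrFun hxy a) l
    rw [encode₃, encode₃, hc', add_right_inj] at h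
    refine apply_eq_of_sum_mul_eq h hi fun j hj => (hs' j).imp_right fun h => hB j ?_
    exact Finset.mem_of_mem_insert_of_ne h hj
  · obtain ⟨hplain, p, hpi, hB, hv⟩ := carryForm_spec i (by omega) (by omega)
    have hc : ∀ k, carrySum x k = carrySum y k := fun k => carrySum_eq_of_plainSum_eq hxy fun l =>
      sum_mul_congr fun j => (hs' j).imp_right fun h => hplain j h k l
    have key : ∑ j, (∑ k, carryForm i k * carryCoeff k j) *
        (((x j).val : ZMod 9) - ((y j).val : ZMod 9)) = 0 := by
      have : ∑ k, carryForm i k * (carrySum x k - carrySum y k) = 0 := by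
        simp only [hc, sub_self, mul_zero, Finset.sum_const_zero]
      rw [← this]
      simp only [carrySum, ← Finset.sum_sub_distrib, ← mul_sub, Finset.sum_mul, Finset.mul_sum,
        mul_assoc]
      exact Finset.sum_comm
    refine eq_of_digits _ hv (x i) (x p) (y i) (y p) (Eq.trans ?_ key)
    dsimp only
    rw [← Finset.sum_pair (f := fun j => (∑ k, carryForm i k * carryCoeff k j) *
        (((x j).val : ZMod 9) - ((y j).val : ZMod 9))) hpi.symm]
    refine Finset.sum_subset (Finset.subset_univ _) fun j _ hj => ?_
    rw [Finset.mem_insert, Finset.mem_singleton, not_or] at hj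
    rcases hs' j with h | h
    · rw [h, sub_self, mul_zero]
    · rw [hB j (Finset.mem_of_mem_insert_of_ne h hj.1) hj.2, zero_mul]

end Decoding

/-- A code of rate eight for `I₃` over `GF(3)`. Its broadcasts for the messages with `x₉ = 1`, with
`x₁₁ = 2` and with both show that it is not even affine, as `1 + 2` has a carry. -/
theorem exists_code₃ : ∃ C : IndexCode I₃ (ZMod 3) 1 8,
    ∃ x y, C.encode (x + y) + C.encode 0 ≠ C.encode x + C.encode y := by
  obtain ⟨C, hC⟩ := IndexCode.exists_encode_eq (I := I₃) (X := ZMod 3) (t := 1)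
    (fun x (s : Fin (4 * 2)) => encode₃ (fun j => x j 0) (finProdFinEquiv.symm s).1
      (finProdFinEquiv.symm s).2) <| by
      intro i x y hxy hs
      funext k
      rw [Subsingleton.elim k 0]
      refine apply_eq_of_encode₃_eq (x := fun j => x j 0) (y := fun j => y j 0) ?_
        fun l hl hB => by rw [hs l hl hB]
      funext k l
      have h := congrFun hxy (finProdFinEquiv (k, l))
      beta_reduce at h
      rwa [Equiv.symm_apply_apply] at h
  refine ⟨C, fun j _ => if j = 8 then 1 else 0, fun j _ => if j = 10 then 2 else 0, fun h => ?_⟩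
  rw [hC] at h
  revert h
  decide +kernel

end Constructions

/-! ### The two connections -/

section Connections

open Module

variable {F V W : Type*} [Field F] [AddCommGroup V] [Module F V] [AddCommGroup W] [Module F W]
variable [FiniteDimensional F W]

theorem IsLinearSolution.finrank_le_I₁ {h : Fin 29 → V →ₗ[F] W} (hI : IsLinearSolution I₁ h) :
    4 * finrank F V ≤ finrank F W := by
  simpa using hI.card_mul_finrank_le I₁_clique

theorem IsLinearSolution.finrank_le_I₃ {h : Fin 58 → V →ₗ[F] W} (hI : IsLinearSolution I₃ h) :
    8 * finrank F V ≤ finrank F W := by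
  simpa using hI.card_mul_finrank_le I₃_clique

variable [FiniteDimensional F V]

/-- Over every field one of the two parts has a defect of at least `1 / 11` of a message. -/
theorem IsLinearSolution.noWay_bound {h : Fin 29 ⊕ Fin 58 → V →ₗ[F] W}
    (hI : IsLinearSolution (I₁.noWay I₃) h) : 133 * finrank F V ≤ 11 * finrank F W := by
  obtain ⟨S, h₁, h₂, hh₁, hh₂, hS⟩ := hI.exists_noWay_split
  have e₁ := hh₁.finrank_le_I₁
  have e₂ := hh₂.finrank_le_I₃
  by_cases h3 : (3 : F) = 0
  · have := hh₂.I₃_bound h3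
    omega
  · have := hh₁.I₁_bound h3
    omega

theorem IsLinearSolution.twoWay_bound {Ia : Instance (Fin 4)} (ha : Ia.IsAcyclic)
    {h : (Fin 29 ⊕ Fin 4) ⊕ Fin 58 → V →ₗ[F] W}
    (hI : IsLinearSolution ((I₁.noWay Ia).twoWay I₃) h) :
    89 * finrank F V ≤ 11 * finrank F W := by
  by_cases h3 : (3 : F) = 0
  · exact hI.twoWay_right.I₃_bound h3
  · obtain ⟨S, h₁, h₂, hh₁, hh₂, hS⟩ := hI.twoWay_left.exists_noWay_split
    have e₁ := hh₁.I₁_bound h3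
    have e₂ := hh₂.card_mul_finrank_le_of_isAcyclic ha
    rw [Fintype.card_fin] at e₂
    omega

theorem noWay_linearBroadcastRateOver (F : Type) [Field F] :
    133 / 11 ≤ linearBroadcastRateOver F (I₁.noWay I₃) := by
  refine le_linearBroadcastRateOver F fun t r C => ?_
  have h := C.isLinearSolution.noWay_bound
  rw [finrank_fin_fun, finrank_fin_fun] at h
  have h' : (133 : ℝ) * t ≤ 11 * r := by exact_mod_cast h
  linarith

theorem twoWay_linearBroadcastRateOver (F : Type) [Field F] {Ia : Instance (Fin 4)}
    (ha : Ia.IsAcyclic) : 89 / 11 ≤ linearBroadcastRateOver F ((I₁.noWay Ia).twoWay I₃) := by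
  refine le_linearBroadcastRateOver F fun t r C => ?_
  have h := C.isLinearSolution.twoWay_bound ha
  rw [finrank_fin_fun, finrank_fin_fun] at h
  have h' : (89 : ℝ) * t ≤ 11 * r := by exact_mod_cast h
  linarith

theorem exists_noWay_code :
    ∃ C : IndexCode (I₁.noWay I₃) (ZMod 3) 1 12, ¬ IsLinearMap (ZMod 3) C.encode := by
  obtain ⟨C⟩ := exists_code₁
  obtain ⟨D, x, y, hD⟩ := exists_code₃
  obtain ⟨E, hE⟩ := C.exists_noWay D
  refine ⟨E, fun hlin => hD ?_⟩
  have h := hlin.map_add (Sum.elim 0 x) (Sum.elim 0 y)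
  rw [← add_zero (E.encode _), ← hlin.map_zero, hE, hE, hE, hE] at h
  funext s
  have h' := congrFun h (Fin.natAdd 4 s)
  simp only [Pi.add_apply, Fin.append_right, Sum.elim_inr] at h'
  exact h'

theorem exists_twoWay_code (Ia : Instance (Fin 4)) :
    ∃ C : IndexCode ((I₁.noWay Ia).twoWay I₃) (ZMod 3) 1 8,
      ¬ IsLinearMap (ZMod 3) C.encode := by
  obtain ⟨C₁⟩ := exists_code₁
  obtain ⟨Ca, -⟩ := IndexCode.nonempty_uncoded (X := ZMod 3) Ia
  obtain ⟨C, -⟩ := C₁.exists_noWay Ca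
  obtain ⟨D, x, y, hD⟩ := exists_code₃
  obtain ⟨E, hE⟩ := C.exists_twoWay D
  refine ⟨E, fun hlin => hD ?_⟩
  have h := hlin.map_add (Sum.elim 0 x) (Sum.elim 0 y)
  rw [← add_zero (E.encode _), ← hlin.map_zero, hE, hE, hE, hE] at h
  simp only [Pi.add_apply, Sum.elim_inl, Sum.elim_inr, Pi.zero_apply, add_zero] at h
  rw [add_add_add_comm, add_add_add_comm (C.encode _) _ (C.encode _)] at h
  exact add_left_cancel h

theorem noWay_clique {ι κ α β : Type} [Fintype ι] [Fintype κ] {I : Instance ι} {J : Instance κ}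
    {c : α → ι} {d : β → κ} (hc : ∀ a b, a ≠ b → c b ∈ I.B (c a))
    (hd : ∀ a b, a ≠ b → d b ∈ J.B (d a)) (a b : α ⊕ β) (hab : a ≠ b) :
    Sum.map c d b ∈ (I.noWay J).B (Sum.map c d a) := by
  rcases a with a | a <;> rcases b with b | b <;> simp [Instance.noWay]
  · exact hc a b (by simpa using hab)
  · exact hd a b (by simpa using hab)

theorem twoWay_clique {ι κ β : Type} {I : Instance ι} {J : Instance κ} {d : β → κ}
    (hd : ∀ a b, a ≠ b → d b ∈ J.B (d a)) (a b : β) (hab : a ≠ b) :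
    (Sum.inr (d b) : ι ⊕ κ) ∈ (I.twoWay J).B (Sum.inr (d a)) := by
  simpa [Instance.twoWay] using hd a b hab

end Connections

end IndexCoding

open IndexCoding
theorem theorem1 :
    ((I₁.noWay I₃).size = 87 ∧
      (∀ (X : Type) [Finite X] [Nontrivial X], broadcastRate X (I₁.noWay I₃) = 12) ∧
      (∃ C : IndexCode (I₁.noWay I₃) (ZMod 3) 1 12, ¬ IsLinearMap (ZMod 3) C.encode) ∧
      (∀ (F : Type) [Field F], 12 < linearBroadcastRateOver F (I₁.noWay I₃)) ∧
      12 < linearBroadcastRate (I₁.noWay I₃)) ∧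
    (∃ Ia : Instance (Fin 4), Ia.IsAcyclic) ∧
    ∀ Ia : Instance (Fin 4), Ia.IsAcyclic →
      (((I₁.noWay Ia).twoWay I₃).size = 91 ∧
        (∀ (X : Type) [Finite X] [Nontrivial X],
          broadcastRate X ((I₁.noWay Ia).twoWay I₃) = 8) ∧
        (∃ C : IndexCode ((I₁.noWay Ia).twoWay I₃) (ZMod 3) 1 8,
          ¬ IsLinearMap (ZMod 3) C.encode) ∧
        (∀ (F : Type) [Field F], 8 < linearBroadcastRateOver F ((I₁.noWay Ia).twoWay I₃)) ∧
        8 < linearBroadcastRate ((I₁.noWay Ia).twoWay I₃)) := by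
  refine ⟨⟨by simp [Instance.size], fun X _ _ => ?_, exists_noWay_code, fun F _ => ?_, ?_⟩,
    exists_isAcyclic 4, fun Ia ha => ⟨by simp [Instance.size], fun X _ _ => ?_,
      exists_twoWay_code Ia, fun F _ => ?_, ?_⟩⟩
  · obtain ⟨C, -⟩ := exists_noWay_code
    exact_mod_cast broadcastRate_eq (X := X) C (noWay_clique I₁_clique I₃_clique) (by simp)
  · exact lt_of_lt_of_le (by norm_num) (noWay_linearBroadcastRateOver F)
  · exact lt_of_lt_of_le (by norm_num)
      (le_linearBroadcastRate fun F _ => noWay_linearBroadcastRateOver F)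
  · obtain ⟨C, -⟩ := exists_twoWay_code Ia
    exact_mod_cast broadcastRate_eq (X := X) C (twoWay_clique I₃_clique) (by simp)
  · exact lt_of_lt_of_le (by norm_num) (twoWay_linearBroadcastRateOver F ha)
  · exact lt_of_lt_of_le (by norm_num)
      (le_linearBroadcastRate fun F _ => twoWay_linearBroadcastRateOver F ha)
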